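/- Let $n,k$ be integers with $n\ge 0$ and $k\ge 1$, and let $\mathcal D=\mathcal D_1\times\dots\times\mathcal D_n$ be a product of probability distributions on $[0,\infty)$. Draw independently a sample vector $s=(s_1,\dots,s_n)$ and a value vector $v=(v_1,\dots,v_n)$ from $\mathcal D$. An online algorithm for the $k$-uniform matroid on $\{1,\dots,n\}$ (the feasible sets are the sets of at most $k$ elements) knows $s$ but not $\mathcal D$. The elements are then revealed one by one together with their values; each must be accepted or rejected irrevocably when it is revealed, and the set of accepted elements must be feasible at all times. Let $OPT(v)$ denote the maximum of $\sum_{i\in S}v_i$ over all feasible sets $S$. The Rehearsal Algorithm works as follows. Let $s^{(1)}>s^{(2)}>\dots>s^{(n)}$ be the samples in decreasing order and let $m=\lceil k-2\sqrt k\,\rceil$. There are $k$ slots with thresholds $T_j=s^{(j)}$ for $1\le j\le m$ and $T_j=s^{(m)}$ for $m<j\le k$. (Conventions: $s^{(j)}=0$ for $j>n$, and $T_j=s^{(1)}$ for all $j$ if $m\le 0$, that is, if $k\le 4$.) A revealed value is accepted if and only if it exceeds the threshold of some slot that has not been filled yet; it then fills the first such slot, which is one with the highest threshold. There is an absolute constant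 $C$ such that for all $n$ and $k$ the following holds. 1. If the distributions $\mathcal D_i$ have no atoms (so that almost surely no two of the numbers $s_1,\dots,s_n,v_1,\dots,v_n$ are equal), then the set $A^*$ of elements accepted by the Rehearsal Algorithm is always feasible, and $$\mathbb E_{s,v}\Big[\sum_{i\in A^*}v_i\Big]\;\ge\;\Big(1-\frac{C}{\sqrt k}\Big)\,\mathbb E_{v}\big[OPT(v)\big]$$ for every order of arrival, even if it is chosen by an adversary who sees all the values and all the samples in advance. 2. For arbitrary $\mathcal D_i$, the same holds for the Rehearsal Algorithm with random tie-breaking: every sample and every value carries its own independent uniform random number from $[0,1]$, all comparisons are made lexicographically between the pairs (number, random number), a threshold $s^{(j)}$ with $j>n$ counts as the pair $(0,0)$, and the expectation on the left is also over these random numbers, which the adversary may see in advance. (If $1-C/\sqrt k\le 0$ the inequality is void; the expectations may be infinite.) -/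

import Mathlib

open MeasureTheory
open scoped ENNReal NNReal

noncomputable section

/-- The feasible sets of the `k`-uniform matroid on the universe `Fin n`: all sets of at most `k`
elements. -/
def uniformFeasible (n k : ℕ) : Set (Finset (Fin n)) :=
  {S | S.card ≤ k}

/-- `OPT(v)`: the maximum total weight of a feasible set. -/
def optValue {n : ℕ} (J : Set (Finset (Fin n))) (v : Fin n → ℝ≥0) : ℝ≥0∞ :=
  ⨆ S ∈ J, ∑ i ∈ S, (v i : ℝ≥0∞)

/-- A single-sample online selection algorithm on the universe `Fin n`, with random coins in `R`
and memory states in `St`. `init` sees the coins and the sample vector. Each later `step` sees the coins, the current state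
and one revealed element together with its value; it returns the irrevocable decision
(`true` = accept) and the next state. -/
structure SingleSampleAlgorithm (n : ℕ) (R St : Type) where
  /-- offline phase -/
  init : R → (Fin n → ℝ≥0) → St
  /-- online phase -/
  step : R → St → Fin n → ℝ≥0 → Bool × St

namespace SingleSampleAlgorithm

variable {n : ℕ} {R St : Type}

/-- The set of elements accepted when, starting in state `σ`, the elements of the list are revealed
one after the other. -/
def acceptedFrom (A : SingleSampleAlgorithm n R St) (r : R) (v : Fin n → ℝ≥0) :
    St → List (Fin n) → Finset (Fin n)
  | _, [] => ∅
  | σ, i :: l =>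
      if (A.step r σ i (v i)).1 = true then
        insert i (acceptedFrom A r v (A.step r σ i (v i)).2 l)
      else acceptedFrom A r v (A.step r σ i (v i)).2 l

/-- The set of elements accepted with coins `r`, samples `s` and values `v`, after the elements of
the list `l` have been revealed in the order of the list. -/
def accepted (A : SingleSampleAlgorithm n R St) (r : R) (s v : Fin n → ℝ≥0) (l : List (Fin n)) :
    Finset (Fin n) :=
  A.acceptedFrom r v (A.init r s) l

/-- The total value collected when all elements are revealed, element `π j` at time `j`. -/
def reward (A : SingleSampleAlgorithm n R St) (r : R) (s v : Fin n → ℝ≥0) (π : Equiv.Perm (Fin n)) :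
    ℝ≥0∞ :=
  ∑ i ∈ A.accepted r s v (List.ofFn π), (v i : ℝ≥0∞)

/-- At all times, the set of accepted elements is feasible: this holds after any sequence of
pairwise distinct elements has been revealed. -/
def IsFeasible (A : SingleSampleAlgorithm n R St) (J : Set (Finset (Fin n))) : Prop :=
  ∀ (r : R) (s v : Fin n → ℝ≥0) (l : List (Fin n)), l.Nodup → A.accepted r s v l ∈ J

/-- The algorithm has competitive ratio `c` on the product distribution `D 0 × ⋯ × D (n - 1)`
against every adversarial arrival order. The coins have law `P`; the samples and the values are
independent draws from the product distribution. The order may depend on the values, and even on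
the samples and the coins. For an order that is not measurable, the right-hand side is a lower
integral, so the inequality is only stronger than for measurable orders. Expectations may be
infinite. -/
def HasCompetitiveRatio (A : SingleSampleAlgorithm n R St) (J : Set (Finset (Fin n)))
    [MeasurableSpace R] (P : Measure R) (D : Fin n → Measure ℝ≥0) (c : ℝ≥0∞) : Prop :=
  ∀ order : R → (Fin n → ℝ≥0) → (Fin n → ℝ≥0) → Equiv.Perm (Fin n),
    c * ∫⁻ v, optValue J v ∂(Measure.pi D) ≤
      ∫⁻ ω, A.reward ω.1 ω.2.1 ω.2.2 (order ω.1 ω.2.1 ω.2.2)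
        ∂(P.prod ((Measure.pi D).prod (Measure.pi D)))

end SingleSampleAlgorithm

/-- `descending x j` is the `(j+1)`-st largest among the entries of `x` (with multiplicity), and the
bottom element if there are at most `j` entries. -/
def descending {n : ℕ} {α : Type} [LinearOrder α] [OrderBot α] (x : Fin n → α) (j : ℕ) : α :=
  ((Multiset.map x Finset.univ.val).sort (fun a b => b ≤ a)).getD j ⊥

/-- The number `k - 2√k` of distinct thresholds, rounded up. It is positive iff `4 < k`. -/
def numTop (k : ℕ) : ℕ := ⌈(k : ℝ) - 2 * √(k : ℝ)⌉₊

/-- The thresholds of the `k` slots (slot `j : Fin k` is the `(j+1)`-st slot): the top `numTop k`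
samples in decreasing order, and then the `numTop k`-th largest sample repeated. If `numTop k = 0`,
the largest sample is used throughout. -/
def thresholds {n : ℕ} {α : Type} [LinearOrder α] [OrderBot α] (k : ℕ) (x : Fin n → α)
    (j : Fin k) : α :=
  descending x (min (j : ℕ) (numTop k - 1))

/-- The slots, among the available slots `S`, whose threshold lies below `x`. -/
def fillable {α : Type} [LinearOrder α] {k : ℕ} (T : Fin k → α) (S : Finset (Fin k)) (x : α) :
    Finset (Fin k) :=
  S.filter (fun j => T j < x)

/-- The Rehearsal Algorithm. The comparisons take place in a linear order `α`: a sample `x` of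
element `i` is compared through `sKey r i x`, a value `x` of element `i` through `vKey r i x`.
The state consists of the thresholds and the set of available slots, at first all of them. A
revealed value is accepted iff its key exceeds the threshold of some available slot, and it then
fills the first such slot, the one with the highest threshold. -/
def rehearsal (n k : ℕ) {R α : Type} [LinearOrder α] [OrderBot α]
    (sKey vKey : R → Fin n → ℝ≥0 → α) :
    SingleSampleAlgorithm n R ((Fin k → α) × Finset (Fin k)) where
  init r s := (thresholds k (fun i => sKey r i (s i)), Finset.univ)
  step r σ i x :=
    if h : (fillable σ.1 σ.2 (vKey r i x)).Nonempty then
      (true, (σ.1, σ.2.erase ((fillable σ.1 σ.2 (vKey r i x)).min' h)))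
    else (false, σ)

/-- The Rehearsal Algorithm in its plain form: deterministic, comparing the numbers themselves. -/
def plainRehearsal (n k : ℕ) :
    SingleSampleAlgorithm n Unit ((Fin k → ℝ≥0) × Finset (Fin k)) :=
  rehearsal n k (fun _ _ x => x) (fun _ _ x => x)

/-- The Rehearsal Algorithm with random tie-breaking: every sample and every value carries its own
coin in `[0,1]`, and pairs (number, coin) are compared lexicographically. -/
def tieBreakingRehearsal (n k : ℕ) :
    SingleSampleAlgorithm n ((Fin n → unitInterval) × (Fin n → unitInterval))
      ((Fin k → ℝ≥0 ×ₗ unitInterval) × Finset (Fin k)) :=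
  rehearsal (α := ℝ≥0 ×ₗ unitInterval) n k (fun r i x => toLex (x, r.1 i)) (fun r i x => toLex (x, r.2 i))

end

/-! Deferred decisions: each element carries two i.i.d. numbers, and a fair coin decides which one
is the sample and which the value. Fix the 2n numbers, assumed distinct, sort them decreasingly, and
average over the 2^n exchanges `ε`. By Abel summation (`sum_mul_nonneg_of_antitone`) it suffices to
show, for every `p`, that on average the number of accepted values among the top `p` numbers is at
least `1 - 44/√k` times `min k (numValues p)`, which bounds the number that any feasible set
contains.

Reading the sorted list, let the walk go up at a value and down at a sample. A slot is eligible for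
a value according to the number of samples above it, so the rule is first-fit on ranks. Looking at
the last free slot (`IsFirstFit.numValues_le_or`) shows that the deficit (values not accepted so
far) is at most the rise of the walk above some earlier height. At the time `τ` when `m` samples
have been seen the bound improves by `k - m`, thanks to the repeated thresholds. A positive deficit
at `p` therefore forces as many levels that the walk leaves for good before `p`, ending more than `k
- m ≥ √k` higher (`deficit_le_card_escape`). By gambler's ruin each starting time escapes in this
way with probability at most `1/√k` (`card_escapes_mul_le`). The positions after `τ` are lost as
well, but by Chebyshev `m` samples are rarely seen much before time `2k`
(`sum_card_le_numSamples_le`).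

The steps of the walk are not independent, because the two numbers of a pair have opposite signs.
This dependence only helps: exchanging the pair of an upward step can only raise the walk before
that step, so a step is nonpositively correlated with the relevant functions of the past
(`sum_stepSign_mul_nonpos`).

The adversary is handled by bounding the reward for the worst order, separately for every outcome.
-/

noncomputable section

open Finset in
/-- Abel summation: a nonnegative antitone weighting preserves nonnegativity of partial sums. -/
theorem sum_mul_nonneg_of_antitone (N : ℕ) (w d : ℕ → ℝ) (hw : ∀ j < N, 0 ≤ w j)
    (hanti : ∀ j, j + 1 < N → w (j + 1) ≤ w j)
    (hd : ∀ p ≤ N, 0 ≤ ∑ j ∈ range p, d j) : 0 ≤ ∑ j ∈ range N, d j * w j := by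
  -- The induction keeps the last weight times the unweighted partial sum as a lower bound; lowering
  -- the weight only lowers this bound.
  have key : ∀ M, M < N → w M * ∑ j ∈ range (M + 1), d j ≤ ∑ j ∈ range (M + 1), d j * w j := by
    intro M
    induction M with
    | zero => intro _; simp [mul_comm]
    | succ M ih =>
      intro hM
      rw [sum_range_succ, sum_range_succ _ (M + 1)]
      have h1 := ih (by omega)
      have h2 := mul_le_mul_of_nonneg_right (hanti M hM) (hd (M + 1) (by omega))
      nlinarith
  rcases N with _ | M
  · simp
  · exact (mul_nonneg (hw M (by omega)) (hd _ le_rfl)).trans (key M (by omega))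

/-! ### The walk of values against samples under random exchanges -/

section Walk

open Finset

variable {n : ℕ}

/-- The sign of position `j`: `1` if it carries a value, `-1` if it carries a sample. -/
def stepSign (e : ℕ → Fin n × Bool) (ε : Fin n → Bool) (j : ℕ) : ℤ :=
  if ε (e j).1 = (e j).2 then 1 else -1

/-- The surplus of values over samples among the first `q` positions. -/
def walk (e : ℕ → Fin n × Bool) (ε : Fin n → Bool) (q : ℕ) : ℤ :=
  ∑ j ∈ range q, stepSign e ε j

/-- The number of values among the first `q` positions. -/
def numValues (e : ℕ → Fin n × Bool) (ε : Fin n → Bool) (q : ℕ) : ℕ :=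
  #{j ∈ range q | ε (e j).1 = (e j).2}

/-- The number of samples among the first `q` positions. -/
def numSamples (e : ℕ → Fin n × Bool) (ε : Fin n → Bool) (q : ℕ) : ℕ :=
  #{j ∈ range q | ε (e j).1 ≠ (e j).2}

/-- Exchange the roles of the two numbers of pair `i`. -/
def flipAt (i : Fin n) (ε : Fin n → Bool) : Fin n → Bool :=
  Function.update ε i (!ε i)

theorem flipAt_involutive (i : Fin n) : Function.Involutive (flipAt i) := by
  intro ε
  simp [flipAt]

variable {e : ℕ → Fin n × Bool} {ε : Fin n → Bool}

theorem numValues_add_numSamples (q : ℕ) : numValues e ε q + numSamples e ε q = q := by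
  simpa [numValues, numSamples] using
    card_filter_add_card_filter_not (s := range q) (fun j => ε (e j).1 = (e j).2)

theorem walk_eq (q : ℕ) : walk e ε q = numValues e ε q - numSamples e ε q := by
  simp only [walk, stepSign, numValues, numSamples, sum_ite, sum_const, nsmul_eq_mul]
  ring

theorem walk_succ (q : ℕ) : walk e ε (q + 1) = walk e ε q + stepSign e ε q :=
  sum_range_succ _ _

theorem stepSign_eq (j : ℕ) : stepSign e ε j = 1 ∨ stepSign e ε j = -1 := by
  unfold stepSign; split_ifs <;> simp

theorem stepSign_eq_one_iff (j : ℕ) : stepSign e ε j = 1 ↔ ε (e j).1 = (e j).2 := by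
  unfold stepSign; split_ifs <;> simp_all

theorem numSamples_mono (ε : Fin n → Bool) : Monotone (numSamples e ε) := fun _ _ h =>
  card_le_card (filter_subset_filter _ (range_subset_range.2 h))

theorem numValues_mono (ε : Fin n → Bool) : Monotone (numValues e ε) := fun _ _ h =>
  card_le_card (filter_subset_filter _ (range_subset_range.2 h))

theorem numSamples_zero : numSamples e ε 0 = 0 := by simp [numSamples]

theorem numSamples_succ (q : ℕ) :
    numSamples e ε (q + 1) = numSamples e ε q + if ε (e q).1 = (e q).2 then 0 else 1 := by
  unfold numSamples
  rw [range_add_one, filter_insert]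
  by_cases h : ε (e q).1 = (e q).2 <;> simp [h]

theorem stepSign_flipAt_self (q : ℕ) :
    stepSign e (flipAt (e q).1 ε) q = -stepSign e ε q := by
  unfold stepSign flipAt
  cases h1 : ε (e q).1 <;> cases h2 : (e q).2 <;> simp

/-- The exchange affects only the two positions of the pair of `q`. If the partner precedes `q`, it
was a sample and becomes a value. -/
theorem stepSign_le_flipAt {N q j : ℕ} (he : Set.InjOn e (Set.Iio N)) (hq : q < N) (hj : j < q)
    (h : stepSign e ε q = 1) : stepSign e ε j ≤ stepSign e (flipAt (e q).1 ε) j := by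
  by_cases hi : (e j).1 = (e q).1
  · have hne : (e j).2 ≠ (e q).2 := fun h2 =>
      hj.ne (he (show j < N by omega) hq (Prod.ext hi h2))
    rw [stepSign_eq_one_iff] at h
    have : stepSign e (flipAt (e q).1 ε) j = 1 := by
      rw [stepSign_eq_one_iff, hi]
      simp only [flipAt, Function.update_self, h]
      revert hne
      cases (e j).2 <;> cases (e q).2 <;> simp
    rw [this]
    rcases stepSign_eq (e := e) (ε := ε) j with h | h <;> simp [h]
  · simp [stepSign, flipAt, Function.update_of_ne hi]

/-- A step is nonpositively correlated with every function that can only grow when the pair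
of a positive step is exchanged. -/
theorem sum_stepSign_mul_nonpos (q : ℕ) (f : (Fin n → Bool) → ℤ)
    (hf : ∀ ε, stepSign e ε q = 1 → f ε ≤ f (flipAt (e q).1 ε)) :
    ∑ ε, stepSign e ε q * f ε ≤ 0 := by
  -- Reindexing by the exchange and adding the two forms of the sum groups each `ε` with its
  -- partner, whose step has the opposite sign.
  have h1 : ∑ ε, stepSign e ε q * f ε =
      ∑ ε, stepSign e (flipAt (e q).1 ε) q * f (flipAt (e q).1 ε) :=
    (Equiv.sum_comp (flipAt_involutive (e q).1).toPerm (fun ε => stepSign e ε q * f ε)).symm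
  have h2 : ∑ ε, (stepSign e ε q * f ε +
      stepSign e (flipAt (e q).1 ε) q * f (flipAt (e q).1 ε)) ≤ 0 := by
    refine sum_nonpos fun ε _ => ?_
    rw [stepSign_flipAt_self]
    rcases stepSign_eq (e := e) (ε := ε) q with h | h
    · have := hf ε h
      rw [h]; linarith
    · have := hf (flipAt (e q).1 ε) (by rw [stepSign_flipAt_self, h]; rfl)
      rw [flipAt_involutive (e q).1 ε] at this
      rw [h]; linarith
  rw [sum_add_distrib, ← h1] at h2
  linarith

theorem sum_stepSign (q : ℕ) : ∑ ε, stepSign e ε q = 0 := by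
  apply le_antisymm
  · simpa using sum_stepSign_mul_nonpos (e := e) q (fun _ => 1) (fun _ _ => le_rfl)
  · simpa using sum_stepSign_mul_nonpos (e := e) q (fun _ => -1) (fun _ _ => le_rfl)

theorem sum_walk (q : ℕ) : ∑ ε, walk e ε q = 0 := by
  simp only [walk]
  rw [sum_comm]
  exact sum_eq_zero fun j _ => sum_stepSign j

theorem two_mul_sum_numValues (q : ℕ) : 2 * ∑ ε, (numValues e ε q : ℤ) = 2 ^ n * q := by
  have h : ∀ ε : Fin n → Bool, 2 * (numValues e ε q : ℤ) = walk e ε q + q := by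
    intro ε
    have := numValues_add_numSamples (e := e) (ε := ε) q
    rw [walk_eq]; omega
  rw [mul_sum, sum_congr rfl fun ε _ => h ε, sum_add_distrib, sum_walk]
  simp

theorem walk_sub_walk_le_flipAt {N q r q' : ℕ} (he : Set.InjOn e (Set.Iio N)) (hq : q < N)
    (hr : r ≤ q') (hq' : q' ≤ q) (h : stepSign e ε q = 1) :
    walk e ε q' - walk e ε r ≤
      walk e (flipAt (e q).1 ε) q' - walk e (flipAt (e q).1 ε) r := by
  simp only [walk, ← sum_Ico_eq_sub _ hr]
  exact sum_le_sum fun j hj => stepSign_le_flipAt he hq (by simp at hj; omega) h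

theorem numSamples_flipAt_le {N q : ℕ} (he : Set.InjOn e (Set.Iio N)) (hq : q < N)
    (h : stepSign e ε q = 1) : numSamples e (flipAt (e q).1 ε) q ≤ numSamples e ε q := by
  have h1 := walk_sub_walk_le_flipAt he hq (Nat.zero_le q) le_rfl h
  have h2 := numValues_add_numSamples (e := e) (ε := ε) q
  have h3 := numValues_add_numSamples (e := e) (ε := flipAt (e q).1 ε) q
  have h4 : ∀ ε', walk e ε' 0 = 0 := fun ε' => by simp [walk]
  rw [h4, h4, walk_eq, walk_eq] at h1
  omega

/-- The second moment is at most that of a walk with independent steps: the cross term of a step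
with the walk before it is nonpositive. -/
theorem sum_walk_sq_le {N : ℕ} (he : Set.InjOn e (Set.Iio N)) (q : ℕ) (hq : q ≤ N) :
    ∑ ε, walk e ε q ^ 2 ≤ 2 ^ n * q := by
  induction q with
  | zero => simp [walk]
  | succ q ih =>
    have h1 : ∑ ε, stepSign e ε q * walk e ε q ≤ 0 := by
      refine sum_stepSign_mul_nonpos q _ fun ε h => ?_
      simpa [walk] using walk_sub_walk_le_flipAt he hq (Nat.zero_le q) le_rfl h
    have h2 : ∀ ε : Fin n → Bool, walk e ε (q + 1) ^ 2 =
        walk e ε q ^ 2 + 2 * (stepSign e ε q * walk e ε q) + 1 := by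
      intro ε
      rw [walk_succ]
      rcases stepSign_eq (e := e) (ε := ε) q with h | h <;> rw [h] <;> ring
    rw [sum_congr rfl fun ε _ => h2 ε, sum_add_distrib, sum_add_distrib, ← mul_sum]
    have := ih (by omega)
    simp only [sum_const, card_univ, Fintype.card_fun, Fintype.card_bool, Fintype.card_fin,
      nsmul_eq_mul]
    push_cast
    linarith

/-- Chebyshev's inequality for the number of samples. -/
theorem card_le_numSamples_mul_le {N m q : ℕ} (he : Set.InjOn e (Set.Iio N)) (hq : q ≤ N)
    (hqm : q ≤ 2 * m) :
    (#{ε : Fin n → Bool | m ≤ numSamples e ε q} : ℤ) * (2 * m - q) ^ 2 ≤ 2 ^ n * q := by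
  refine le_trans ?_ (sum_walk_sq_le he q hq)
  rw [← nsmul_eq_mul, ← sum_const]
  refine (sum_le_sum fun ε hε => ?_).trans
    (sum_le_sum_of_subset_of_nonneg (subset_univ _) fun ε _ _ => sq_nonneg (walk e ε q))
  have h2 := numValues_add_numSamples (e := e) (ε := ε) q
  have h3 := (mem_filter.1 hε).2
  -- With at least `m` samples among `q` positions the walk is at most `q - 2m ≤ 0`.
  rw [walk_eq, ← neg_sq ((numValues e ε q : ℤ) - numSamples e ε q)]
  exact pow_le_pow_left₀ (by omega) (by omega) 2

/-- Time `τ` is the first time when `m` samples have been seen or all `N` positions, the walk is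
then more than `h` above its height at time `r`, and it has stayed above that height since. -/
def EscapesAt (e : ℕ → Fin n × Bool) (N m h r τ : ℕ) (ε : Fin n → Bool) : Prop :=
  r < τ ∧ τ ≤ N ∧ (∀ q < τ, numSamples e ε q < m) ∧
    (τ < N → m ≤ numSamples e ε τ) ∧
    (∀ q, r < q → q ≤ τ → walk e ε r < walk e ε q) ∧ walk e ε r + h < walk e ε τ

/-- The walk has been above its height at time `r` from then until time `q < N`, and `m` samples
have not been seen yet. -/
def Survives (e : ℕ → Fin n × Bool) (N m r q : ℕ) (ε : Fin n → Bool) : Prop :=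
  q < N ∧ numSamples e ε q < m ∧ ∀ q', r < q' → q' ≤ q → walk e ε r < walk e ε q'

theorem Survives.flipAt {N m r q : ℕ} (he : Set.InjOn e (Set.Iio N))
    (hs : Survives e N m r q ε) (h : stepSign e ε q = 1) :
    Survives e N m r q (flipAt (e q).1 ε) := by
  obtain ⟨h1, h2, h3⟩ := hs
  refine ⟨h1, (numSamples_flipAt_le he h1 h).trans_lt h2, fun q' hr hq => ?_⟩
  have := walk_sub_walk_le_flipAt he h1 hr.le hq h
  have := h3 q' hr hq
  omega

theorem EscapesAt.survives {N m h r q : ℕ} (hs : EscapesAt e N m h r (q + 1) ε) :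
    Survives e N m r q ε :=
  ⟨by have := hs.2.1; omega, hs.2.2.1 q (by omega), fun q' h1 h2 => hs.2.2.2.2.1 q' h1 (by omega)⟩

theorem EscapesAt.not_survives {N m h r q : ℕ} (hs : EscapesAt e N m h r q ε) :
    ¬ Survives e N m r q ε := fun h1 => by
  have := hs.2.2.2.1 h1.1
  have := h1.2.1
  omega

theorem Survives.pred {N m r q : ℕ} (hs : Survives e N m r (q + 1) ε) :
    Survives e N m r q ε :=
  ⟨by have := hs.1; omega, (numSamples_mono ε (Nat.le_succ q)).trans_lt hs.2.1,
    fun q' h1 h2 => hs.2.2 q' h1 (by omega)⟩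

-- Optional stopping in supermartingale form: the height above time `r`, stopped on returning to it
-- or on escaping, does not increase on average, and it is at most 1 after one step. An escape pays
-- at least `h`.
open Classical in
theorem sum_survives_add_escapesAt_le {N m h r q : ℕ} (he : Set.InjOn e (Set.Iio N))
    (hrq : r < q) (hqN : q ≤ N) :
    ∑ ε, (if Survives e N m r q ε then walk e ε q - walk e ε r else 0) +
      ∑ τ ∈ range (q + 1), ∑ ε, (if EscapesAt e N m h r τ ε then (h : ℤ) else 0) ≤ 2 ^ n := by
  induction q, hrq using Nat.le_induction with
  | base =>
    have h1 : ∑ τ ∈ range (r + 1), ∑ ε, (if EscapesAt e N m h r τ ε then (h : ℤ) else 0) = 0 := by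
      refine sum_eq_zero fun τ hτ => sum_eq_zero fun ε _ => if_neg fun hs => ?_
      have := hs.1
      simp at hτ
      omega
    rw [sum_range_succ, h1, zero_add, ← sum_add_distrib]
    have h2 : ∀ ε, (if Survives e N m r (r + 1) ε then walk e ε (r + 1) - walk e ε r else 0) +
        (if EscapesAt e N m h r (r + 1) ε then (h : ℤ) else 0) ≤ 1 := by
      intro ε
      have h3 := stepSign_eq (e := e) (ε := ε) r
      have h4 := walk_succ (e := e) (ε := ε) r
      by_cases h5 : EscapesAt e N m h r (r + 1) ε
      · rw [if_neg h5.not_survives, if_pos h5]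
        have := h5.2.2.2.2.2
        omega
      · rw [if_neg h5]
        split_ifs <;> omega
    refine (sum_le_sum fun ε _ => h2 ε).trans ?_
    simp
  | succ q hq ih =>
    have hq' : r < q := hq
    rw [sum_range_succ, add_comm (∑ τ ∈ range (q + 1), _), ← add_assoc, ← sum_add_distrib]
    refine le_trans ?_ (ih (by omega))
    gcongr ?_ + _
    -- Survival until `q` is preserved when an upward step at `q` is exchanged, so the next step has
    -- nonpositive mean on this event.
    have h1 : ∑ ε, stepSign e ε q * (if Survives e N m r q ε then 1 else 0) ≤ 0 := by
      refine sum_stepSign_mul_nonpos q _ fun ε h => ?_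
      split_ifs with h1 h2
      · exact le_rfl
      · exact absurd (h1.flipAt he h) h2
      · simp
      · exact le_rfl
    -- A walk that drops out without escaping gives up a nonnegative amount: its height above time
    -- `r` was at least 1 and the step is at least -1.
    have h2 : ∀ ε, (if Survives e N m r (q + 1) ε then walk e ε (q + 1) - walk e ε r else 0) +
        (if EscapesAt e N m h r (q + 1) ε then (h : ℤ) else 0) ≤
        (if Survives e N m r q ε then walk e ε q - walk e ε r else 0) +
          stepSign e ε q * (if Survives e N m r q ε then 1 else 0) := by
      intro ε
      have h4 := walk_succ (e := e) (ε := ε) q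
      by_cases h5 : EscapesAt e N m h r (q + 1) ε
      · rw [if_neg h5.not_survives, if_pos h5, if_pos h5.survives, if_pos h5.survives]
        have := h5.2.2.2.2.2
        omega
      · rw [if_neg h5]
        by_cases h6 : Survives e N m r (q + 1) ε
        · rw [if_pos h6, if_pos h6.pred, if_pos h6.pred]
          omega
        · rw [if_neg h6]
          split_ifs with h7
          · have := h7.2.2 q hq' le_rfl
            have := stepSign_eq (e := e) (ε := ε) q
            omega
          · simp
    refine (sum_le_sum fun ε _ => h2 ε).trans ?_
    rw [sum_add_distrib]
    linarith

open Classical in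
/-- Gambler's ruin: an escape by more than `h` has probability at most `1 / h`. -/
theorem card_escapes_mul_le {N m h r : ℕ} (he : Set.InjOn e (Set.Iio N)) :
    (#{ε : Fin n → Bool | ∃ τ, EscapesAt e N m h r τ ε} : ℤ) * h ≤ 2 ^ n := by
  by_cases hrN : r < N
  · refine le_trans ?_ (sum_survives_add_escapesAt_le (m := m) (h := h) he hrN le_rfl)
    -- `Survives` requires `q < N`, so at time `N` only the escape terms are left.
    have h1 : 0 ≤ ∑ ε, (if Survives e N m r N ε then walk e ε N - walk e ε r else 0) :=
      sum_nonneg fun ε _ => by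
        rw [if_neg fun h => lt_irrefl _ h.1]
    refine le_trans ?_ (le_add_of_nonneg_left h1)
    rw [sum_comm, ← nsmul_eq_mul, ← sum_const, sum_filter]
    refine sum_le_sum fun ε _ => ?_
    split_ifs with h2
    · obtain ⟨τ, hτ⟩ := h2
      refine le_trans ?_ (single_le_sum (f := fun τ => if EscapesAt e N m h r τ ε then (h : ℤ) else 0)
        (fun i _ => by positivity) (show τ ∈ range (N + 1) by have := hτ.2.1; simp; omega))
      simp [hτ]
    · exact sum_nonneg fun i _ => by positivity
  · rw [filter_false_of_mem]
    · simp
    · rintro ε - ⟨τ, h1, h2, -⟩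
      omega

/-- If a monotone deficit is at every time at most the rise of the walk above some earlier
height, and at the end at most this rise minus `h`, then it is at most the number of escapes. -/
theorem deficit_le_card_escape (W R : ℕ → ℤ) (τ p : ℕ) (h : ℤ) (hp : p ≤ τ)
    (hW : ∀ j, W (j + 1) ≤ W j + 1) (hR : ∀ q ≤ τ, R p ≤ R q ∨ q < p)
    (h1 : ∀ q ≤ τ, ∃ r ≤ q, R q ≤ W q - W r)
    (h2 : R τ ≤ 0 ∨ ∃ r ≤ τ, R τ ≤ W τ - W r - h) [DecidablePred fun r =>
      (∀ q, r < q → q ≤ τ → W r < W q) ∧ W r + h < W τ] :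
    R p ≤ #{r ∈ range p | (∀ q, r < q → q ≤ τ → W r < W q) ∧ W r + h < W τ} := by
  by_cases hpos : R p ≤ 0
  · exact hpos.trans (by positivity)
  push Not at hpos
  obtain ⟨r₀, hr₀, hmin⟩ := exists_min_image (range (p + 1)) W ⟨0, by simp⟩
  simp only [mem_range] at hr₀ hmin
  -- At a minimum `q₁` of the walk on `[p, τ]`, the reference time `r` of the deficit cannot be `p`
  -- or later, since the rise from `r` to `q₁` is positive. So `r < p`, and `W r ≥ W r₀`.
  have hfut : ∀ q, p ≤ q → q ≤ τ → W r₀ + R p ≤ W q := by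
    obtain ⟨q₁, hq₁, hmin₁⟩ := exists_min_image (Icc p τ) W ⟨p, by simp [hp]⟩
    simp only [mem_Icc] at hq₁ hmin₁
    have : W r₀ + R p ≤ W q₁ := by
      obtain ⟨r, hr, hle⟩ := h1 q₁ hq₁.2
      have h3 := hR q₁ hq₁.2
      by_cases hrp : p ≤ r
      · have := hmin₁ r ⟨hrp, by omega⟩
        omega
      · have := hmin r (by omega)
        omega
    exact fun q h3 h4 => this.trans (hmin₁ q ⟨h3, h4⟩)
  have hend : W r₀ + R p + h ≤ W τ := by
    have h3 := hR τ le_rfl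
    rcases h2 with h2 | ⟨r, hr, hle⟩
    · omega
    · by_cases hrp : p ≤ r
      · have := hfut r hrp hr
        omega
      · have := hmin r (by omega)
        omega
  -- The walk climbs by at most 1 per step, so each of these `R p` levels has a last visit before
  -- `p`. The times of these visits are distinct and are counted on the right-hand side.
  have hex : ∀ ℓ ∈ Ico (W r₀) (W r₀ + R p), ∃ r ∈ ({r ∈ range p |
      (∀ q, r < q → q ≤ τ → W r < W q) ∧ W r + h < W τ} : Finset ℕ), W r = ℓ := by
    intro ℓ hℓ
    rw [mem_Ico] at hℓ
    have hne : ({r ∈ range (p + 1) | W r ≤ ℓ} : Finset ℕ).Nonempty :=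
      ⟨r₀, by simp [hℓ.1]; omega⟩
    obtain ⟨r, hr, hmax⟩ := exists_max_image _ id hne
    simp only [mem_filter, mem_range, id] at hr hmax
    have hWp := hfut p le_rfl hp
    have hrp : r < p := by
      rcases Nat.lt_or_ge r p with h | h
      · exact h
      · have : r = p := by omega
        subst this; omega
    have habove : ∀ q, r < q → q ≤ τ → ℓ < W q := by
      intro q hrq hqτ
      by_cases hqp : p ≤ q
      · have := hfut q hqp hqτ
        omega
      · by_contra hcon
        have := hmax q ⟨by omega, by omega⟩
        omega
    have hWr : W r = ℓ := by
      have := habove (r + 1) (by omega) (by omega)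
      have := hW r
      omega
    refine ⟨r, ?_, hWr⟩
    simp only [mem_filter, mem_range]
    refine ⟨hrp, ?_, by omega⟩
    rw [hWr]; exact habove
  choose! g hg hWg using hex
  have hcard := card_le_card_of_injOn g hg (fun a ha b hb hab => by
    rw [← hWg a ha, ← hWg b hb, hab])
  rw [Int.card_Ico] at hcard
  omega

end Walk

/-! ### First-fit on ranks and the pathwise bound on its deficit -/

section FirstFit

open Finset

variable {n k : ℕ}

/-- The elements accepted when the elements of a list arrive in turn, and each of them takes the
first available slot that is eligible for it according to `E`, if there is one. -/
def firstFit (E : Fin n → Fin k → Bool) : Finset (Fin k) → List (Fin n) → Finset (Fin n)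
  | _, [] => ∅
  | S, i :: l =>
      if h : (S.filter (fun j => E i j)).Nonempty then
        insert i (firstFit E (S.erase ((S.filter (fun j => E i j)).min' h)) l)
      else firstFit E S l

theorem acceptedFrom_rehearsal {R α : Type} [LinearOrder α] [OrderBot α]
    (sKey vKey : R → Fin n → ℝ≥0 → α) (r : R) (v : Fin n → ℝ≥0) (T : Fin k → α)
    (l : List (Fin n)) (S : Finset (Fin k)) :
    (rehearsal n k sKey vKey).acceptedFrom r v (T, S) l =
      firstFit (fun i j => decide (T j < vKey r i (v i))) S l := by
  induction l generalizing S with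
  | nil => rfl
  | cons i l ih =>
    simp only [SingleSampleAlgorithm.acceptedFrom, firstFit, decide_eq_true_eq]
    by_cases h : (fillable T S (vKey r i (v i))).Nonempty
    · have hstep : (rehearsal n k sKey vKey).step r (T, S) i (v i) =
          (true, (T, S.erase ((fillable T S (vKey r i (v i))).min' h))) := dif_pos h
      have h' : {x ∈ S | T x < vKey r i (v i)}.Nonempty := h
      rw [hstep, if_pos rfl, ih, dif_pos h']
      rfl
    · have hstep : (rehearsal n k sKey vKey).step r (T, S) i (v i) = (false, (T, S)) := dif_neg h
      have h' : ¬ {x ∈ S | T x < vKey r i (v i)}.Nonempty := h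
      rw [hstep, if_neg (by simp), ih, dif_neg h']

/-- The elements accepted by first-fit occupy distinct eligible slots, and an element that finds
an eligible slot which is never filled is accepted into an earlier slot. -/
theorem exists_slot_firstFit (hk : 0 < k) (E : Fin n → Fin k → Bool) (l : List (Fin n))
    (hl : l.Nodup) (S : Finset (Fin k)) :
    ∃ σ : Fin n → Fin k, firstFit E S l ⊆ l.toFinset ∧ Set.InjOn σ (firstFit E S l) ∧
      (∀ i ∈ firstFit E S l, σ i ∈ S ∧ E i (σ i)) ∧
      ∀ i ∈ l, ∀ j ∈ S, E i j → (∀ i' ∈ firstFit E S l, σ i' ≠ j) →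
        i ∈ firstFit E S l ∧ σ i < j := by
  induction l generalizing S with
  | nil => exact ⟨fun _ => ⟨0, hk⟩, by simp [firstFit]⟩
  | cons i l ih =>
    obtain ⟨hil, hl⟩ := List.nodup_cons.1 hl
    by_cases h : (S.filter (fun j => E i j)).Nonempty
    · set c := (S.filter (fun j => E i j)).min' h with hc
      have hF : firstFit E S (i :: l) = insert i (firstFit E (S.erase c) l) := dif_pos h
      obtain ⟨σ, h1, h2, h3, h4⟩ := ih hl (S.erase c)
      have hcS := mem_filter.1 (min'_mem _ h)
      rw [← hc] at hcS
      have hi : i ∉ firstFit E (S.erase c) l := fun hi => hil (List.mem_toFinset.1 (h1 hi))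
      have hne : ∀ i' ∈ firstFit E (S.erase c) l, i' ≠ i := fun i' h h' => hi (h' ▸ h)
      refine ⟨Function.update σ i c, ?_, ?_, ?_, ?_⟩
      · rw [hF, List.toFinset_cons]
        exact insert_subset_insert _ h1
      · rw [hF, coe_insert]
        intro a ha b hb hab
        rcases Set.mem_insert_iff.1 ha with rfl | ha <;> rcases Set.mem_insert_iff.1 hb with rfl | hb
        · rfl
        · rw [Function.update_self, Function.update_of_ne (hne b hb)] at hab
          exact absurd hab.symm (ne_of_mem_erase (h3 b hb).1)
        · rw [Function.update_self, Function.update_of_ne (hne a ha)] at hab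
          exact absurd hab (ne_of_mem_erase (h3 a ha).1)
        · rw [Function.update_of_ne (hne a ha), Function.update_of_ne (hne b hb)] at hab
          exact h2 ha hb hab
      · rw [hF]
        intro a ha
        rcases mem_insert.1 ha with rfl | ha
        · simpa using hcS
        · rw [Function.update_of_ne (hne a ha)]
          exact ⟨mem_of_mem_erase (h3 a ha).1, (h3 a ha).2⟩
      · rw [hF]
        intro a ha j hj hE hfree
        have hjc : c ≠ j := by simpa using hfree i (mem_insert_self _ _)
        rcases List.mem_cons.1 ha with rfl | ha
        · refine ⟨mem_insert_self _ _, ?_⟩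
          rw [Function.update_self]
          exact lt_of_le_of_ne (min'_le _ _ (mem_filter.2 ⟨hj, hE⟩)) hjc
        · have hai : a ≠ i := fun h => hil (h ▸ ha)
          obtain ⟨h5, h6⟩ := h4 a ha j (mem_erase.2 ⟨hjc.symm, hj⟩) hE fun i' hi' => by
            have := hfree i' (mem_insert_of_mem hi')
            rwa [Function.update_of_ne (hne i' hi')] at this
          exact ⟨mem_insert_of_mem h5, by rwa [Function.update_of_ne hai]⟩
    · have hF : firstFit E S (i :: l) = firstFit E S l := dif_neg h
      obtain ⟨σ, h1, h2, h3, h4⟩ := ih hl S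
      rw [hF]
      refine ⟨σ, ?_, h2, h3, ?_⟩
      · rw [List.toFinset_cons]
        exact h1.trans (subset_insert _ _)
      · intro a ha j hj hE hfree
        rcases List.mem_cons.1 ha with rfl | ha
        · exact absurd ⟨j, mem_filter.2 ⟨hj, hE⟩⟩ h
        · exact h4 a ha j hj hE hfree

/-- The number of values among the first `p` positions that belong to elements of `A`. -/
def numAccepted (e : ℕ → Fin n × Bool) (ε : Fin n → Bool) (A : Finset (Fin n)) (p : ℕ) : ℕ :=
  #{j ∈ range p | ε (e j).1 = (e j).2 ∧ (e j).1 ∈ A}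

variable {e : ℕ → Fin n × Bool} {ε : Fin n → Bool} {A : Finset (Fin n)}

theorem numAccepted_mono : Monotone (numAccepted e ε A) := fun _ _ h =>
  card_le_card (filter_subset_filter _ (range_subset_range.2 h))

theorem numValues_eq_numAccepted_add (p : ℕ) : numValues e ε p =
    numAccepted e ε A p + #{j ∈ range p | ε (e j).1 = (e j).2 ∧ (e j).1 ∉ A} := by
  rw [numValues, numAccepted, ← filter_filter, ← filter_filter,
    card_filter_add_card_filter_not]

theorem numAccepted_le_card {N p : ℕ} (he : Set.InjOn e (Set.Iio N)) (hp : p ≤ N) :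
    numAccepted e ε A p ≤ #A := by
  refine card_le_card_of_injOn (fun j => (e j).1) (fun j hj => by simp at hj; exact hj.2.2) ?_
  intro j hj j' hj' h
  simp only [coe_filter, mem_range, Set.mem_ofPred_eq] at hj hj' h
  refine he (show j < N by omega) (show j' < N by omega) (Prod.ext h ?_)
  rw [← hj.2.1, ← hj'.2.1, h]

theorem numAccepted_le_numValues (p : ℕ) : numAccepted e ε A p ≤ numValues e ε p := by
  rw [numValues_eq_numAccepted_add (A := A)]; omega

/-- The outcome of a first-fit procedure in which slot `c` is eligible for the value at position
`j` iff at most `min c (m - 1)` samples precede position `j`: the set `A` of accepted elements and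
their slots. -/
structure IsFirstFit (e : ℕ → Fin n × Bool) (ε : Fin n → Bool) (N m : ℕ) (A : Finset (Fin n))
    (σ : Fin n → Fin k) : Prop where
  injOn : Set.InjOn σ A
  eligible : ∀ j < N, ε (e j).1 = (e j).2 → (e j).1 ∈ A →
    numSamples e ε j ≤ min (σ (e j).1 : ℕ) (m - 1)
  accepts : ∀ j < N, ε (e j).1 = (e j).2 → ∀ c : Fin k, numSamples e ε j ≤ min (c : ℕ) (m - 1) →
    (∀ i ∈ A, σ i ≠ c) → (e j).1 ∈ A ∧ σ (e j).1 < c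

/-- Let `g` be the last free slot among the first `J`. Values preceded by at most `g` samples must
all have gone to slots before `g`, while the slots between `g` and `J` are full. The two groups are
disjoint, and the hypothesis `hqJ` places all of them before `q`. -/
theorem IsFirstFit.numValues_le_or {N m : ℕ} {σ : Fin n → Fin k} (hA : IsFirstFit e ε N m A σ)
    (he : Set.InjOn e (Set.Iio N)) (hsurj : ∀ x, ∃ j < N, e j = x) {q J : ℕ} (hqN : q ≤ N)
    (hq : ∀ j < q, numSamples e ε j < m) (hJ : J ≤ k)
    (hqJ : ∀ j < N, ε (e j).1 = (e j).2 → (e j).1 ∈ A → (σ (e j).1 : ℕ) < J → j < q) :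
    numValues e ε q ≤ numAccepted e ε A q ∨
      ∃ r ≤ q, numValues e ε r + J ≤ numAccepted e ε A q + numSamples e ε r := by
  choose pos hposN hpos using fun i => hsurj (i, ε i)
  have hval : ∀ i, ε (e (pos i)).1 = (e (pos i)).2 := fun i => by rw [hpos]
  have hfst : ∀ i, (e (pos i)).1 = i := fun i => by rw [hpos]
  have hcount : ∀ B ⊆ A, (∀ i ∈ B, pos i < q) → #B ≤ numAccepted e ε A q := by
    intro B hBA hB
    refine card_le_card_of_injOn pos (fun i hi => ?_) fun i _ i' _ h => ?_
    · have := hB i hi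
      simp [this, hpos, hBA hi]
    · rw [← hfst i, ← hfst i', h]
  have hlt : ∀ i ∈ A, (σ i : ℕ) < J → pos i < q := fun i hi h =>
    hqJ (pos i) (hposN i) (hval i) (by rwa [hfst]) (by rwa [hfst])
  by_cases hfull : ∀ c : Fin k, (c : ℕ) < J → ∃ i ∈ A, σ i = c
  · right
    -- If the first `J` slots are all full, there are `J` accepted values before `q`, and the
    -- trivial time 0 serves as reference.
    refine ⟨0, Nat.zero_le _, ?_⟩
    have h1 : J ≤ #{i ∈ A | (σ i : ℕ) < J} := by
      have : range J ⊆ ({i ∈ A | (σ i : ℕ) < J} : Finset _).image (fun i => (σ i : ℕ)) := by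
        intro c hc
        rw [mem_range] at hc
        obtain ⟨i, hi, hic⟩ := hfull ⟨c, by omega⟩ hc
        refine mem_image.2 ⟨i, mem_filter.2 ⟨hi, ?_⟩, ?_⟩ <;> simp [hic, hc]
      simpa using (card_le_card this).trans card_image_le
    have h2 := hcount _ (filter_subset (fun i => (σ i : ℕ) < J) A) fun i hi =>
      hlt i (mem_filter.1 hi).1 (mem_filter.1 hi).2
    have h3 : numValues e ε 0 = 0 := by simp [numValues]
    omega
  · push Not at hfull
    obtain ⟨g, ⟨hgJ, hgfree⟩, hgmax⟩ : ∃ g : Fin k, ((g : ℕ) < J ∧ ∀ i ∈ A, σ i ≠ g) ∧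
        ∀ c : Fin k, (c : ℕ) < J → (∀ i ∈ A, σ i ≠ c) → c ≤ g := by
      obtain ⟨c, hc⟩ := hfull
      obtain ⟨g, hg, hmax⟩ := exists_max_image
        (univ.filter fun c : Fin k => (c : ℕ) < J ∧ ∀ i ∈ A, σ i ≠ c) id ⟨c, by simpa using hc⟩
      simp only [mem_filter, mem_univ, true_and, id] at hg hmax
      exact ⟨g, hg, fun c h1 h2 => hmax c ⟨h1, h2⟩⟩
    have hacc : ∀ j < q, numSamples e ε j ≤ g → ε (e j).1 = (e j).2 →
        (e j).1 ∈ A ∧ σ (e j).1 < g := fun j hj hjg hv =>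
      hA.accepts j (by omega) hv g (by have := hq j hj; omega) hgfree
    by_cases hqg : numSamples e ε q ≤ g
    · left
      refine card_le_card fun j hj => ?_
      simp only [mem_filter, mem_range] at hj ⊢
      exact ⟨hj.1, hj.2, (hacc j hj.1 ((numSamples_mono ε hj.1.le).trans hqg) hj.2).1⟩
    · right
      push Not at hqg
      have hex : ∃ r, (g : ℕ) < numSamples e ε r := ⟨q, hqg⟩
      -- The reference time is the first one with `g + 1` samples; all values before it are eligible
      -- for slot `g`.
      obtain ⟨r, hr, hrq, hmin⟩ : ∃ r, (g : ℕ) < numSamples e ε r ∧ r ≤ q ∧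
          ∀ j < r, numSamples e ε j ≤ g :=
        ⟨Nat.find hex, Nat.find_spec hex, Nat.find_min' hex hqg, fun j hj =>
          not_lt.1 (Nat.find_min hex hj)⟩
      have hrg : numSamples e ε r ≤ g + 1 := by
        rcases r with _ | r
        · simp [numSamples_zero]
        · have := hmin r (by omega)
          rw [numSamples_succ]
          split_ifs <;> omega
      refine ⟨r, hrq, ?_⟩
      set A₁ : Finset (Fin n) := {i | pos i < r} with hA₁
      set A₂ : Finset (Fin n) := {i ∈ A | g < σ i ∧ (σ i : ℕ) < J} with hA₂
      have hA₁acc : ∀ i ∈ A₁, i ∈ A ∧ σ i < g := by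
        intro i hi
        have hi' : pos i < r := by simpa [hA₁] using hi
        have := hacc (pos i) (by omega) (hmin _ hi') (hval i)
        rwa [hfst] at this
      have hdisj : Disjoint A₁ A₂ := by
        rw [disjoint_left]
        intro i h1 h2
        exact lt_asymm (hA₁acc i h1).2 (mem_filter.1 h2).2.1
      have h1 : numValues e ε r ≤ #A₁ := by
        refine card_le_card_of_injOn (fun j => (e j).1) (fun j hj => ?_) ?_
        · simp only [coe_filter, mem_range, Set.mem_ofPred_eq] at hj
          have h2 : e (pos (e j).1) = e j := by
            rw [hpos]; exact Prod.ext rfl hj.2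
          have h3 : pos (e j).1 = j := he (hposN _) (show j < N by omega) h2
          simp [hA₁, h3, hj.1]
        · intro j hj j' hj' h
          simp only [coe_filter, mem_range, Set.mem_ofPred_eq] at hj hj' h
          refine he (show j < N by omega) (show j' < N by omega) (Prod.ext h ?_)
          rw [← hj.2, ← hj'.2, h]
      have h2 : J - (g + 1) ≤ #A₂ := by
        have : Ioo (g : ℕ) J ⊆ A₂.image (fun i => (σ i : ℕ)) := by
          intro c hc
          rw [mem_Ioo] at hc
          have hex : ∃ i ∈ A, σ i = ⟨c, by omega⟩ := by
            by_contra hcon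
            push Not at hcon
            have := hgmax ⟨c, by omega⟩ hc.2 hcon
            rw [Fin.le_def] at this
            simp at this
            omega
          obtain ⟨i, hi, hic⟩ := hex
          refine mem_image.2 ⟨i, mem_filter.2 ⟨hi, ?_⟩, by simp [hic]⟩
          rw [hic, Fin.lt_def]
          exact hc
        have := (card_le_card this).trans card_image_le
        rw [Nat.card_Ioo] at this
        omega
      have h3 := hcount (A₁ ∪ A₂) (union_subset (fun i hi => (hA₁acc i hi).1) (filter_subset _ _))
        fun i hi => by
          rcases mem_union.1 hi with hi | hi
          · have : pos i < r := by simpa [hA₁] using hi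
            omega
          · exact hlt i (mem_filter.1 hi).1 (mem_filter.1 hi).2.2
      rw [card_union_of_disjoint hdisj] at h3
      omega

open Classical in
/-- Up to the number of escapes and the number of early times at which `m` samples have been seen,
first-fit accepts as many of the top values as any set of at most `k` elements contains. -/
theorem IsFirstFit.min_numValues_le {N m : ℕ} {σ : Fin n → Fin k} (hA : IsFirstFit e ε N m A σ)
    (he : Set.InjOn e (Set.Iio N)) (hsurj : ∀ x, ∃ j < N, e j = x) (hm : 0 < m) (hmk : m ≤ k)
    {p : ℕ} (hp : p ≤ N) :
    min k (numValues e ε p) ≤ numAccepted e ε A p +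
      #{r ∈ range (min p (2 * k)) | ∃ τ, EscapesAt e N m (k - m) r τ ε} +
      #{q ∈ range (min p (2 * k)) | m ≤ numSamples e ε q} := by
  have hex : ∃ q, m ≤ numSamples e ε q ∨ N ≤ q := ⟨N, Or.inr le_rfl⟩
  -- From `τ` on, no value exceeds the lowest threshold (or the list is exhausted).
  obtain ⟨τ, hτ, hmin⟩ : ∃ τ, (m ≤ numSamples e ε τ ∨ N ≤ τ) ∧
      ∀ q < τ, numSamples e ε q < m ∧ q < N :=
    ⟨Nat.find hex, Nat.find_spec hex, fun q hq => by simpa using Nat.find_min hex hq⟩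
  have hτN : τ ≤ N := by
    by_contra hcon
    exact lt_irrefl _ (hmin N (by omega)).2
  have hτm : numSamples e ε τ ≤ m := by
    rcases τ with _ | τ
    · simp [numSamples_zero]
    · have := (hmin τ (by omega)).1
      rw [numSamples_succ]
      split_ifs <;> omega
  obtain ⟨p', hp'⟩ : ∃ p', p' = min p (2 * k) := ⟨_, rfl⟩
  obtain ⟨p₁, hp₁⟩ : ∃ p₁, p₁ = min p' τ := ⟨_, rfl⟩
  rw [← hp']
  -- Take `J = numSamples q`: a value in a slot `c < J` is preceded by at most `c` samples, hence
  -- lies before `q`. Then `numValues q - J` is the height of the walk at `q`.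
  have hR : ∀ q, q ≤ τ → ∃ r ≤ q, (numValues e ε q : ℤ) - numAccepted e ε A q ≤
      walk e ε q - walk e ε r := by
    intro q hq
    have hqm := (numSamples_mono (e := e) ε hq).trans hτm
    rcases hA.numValues_le_or he hsurj (q := q) (J := numSamples e ε q) (by omega)
      (fun j hj => (hmin j (by omega)).1) (by omega) (fun j hj hv hjA hσ => by
        by_contra hcon
        have h1 := numSamples_mono (e := e) ε (not_lt.1 hcon)
        have h2 := hA.eligible j hj hv hjA
        omega) with h | ⟨r, hr, h⟩
    · exact ⟨q, le_rfl, by omega⟩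
    · refine ⟨r, hr, ?_⟩
      rw [walk_eq, walk_eq]
      omega
  -- At `τ` all `k` slots qualify, since every accepted value precedes `τ`. Replacing the at most
  -- `m` samples by `J = k` gains `k - m`.
  have hRτ : (numValues e ε τ : ℤ) - numAccepted e ε A τ ≤ 0 ∨ ∃ r ≤ τ,
      (numValues e ε τ : ℤ) - numAccepted e ε A τ ≤
        walk e ε τ - walk e ε r - (k - m : ℕ) := by
    rcases hA.numValues_le_or he hsurj (q := τ) (J := k) hτN
      (fun j hj => (hmin j hj).1) le_rfl (fun j hj hv hjA _ => by
        by_contra hcon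
        have h1 := numSamples_mono (e := e) ε (not_lt.1 hcon)
        have h2 := hA.eligible j hj hv hjA
        omega) with h | ⟨r, hr, h⟩
    · left; omega
    · right
      refine ⟨r, hr, ?_⟩
      rw [walk_eq, walk_eq]
      omega
  have hdef := deficit_le_card_escape (walk e ε)
    (fun q => (numValues e ε q : ℤ) - numAccepted e ε A q) τ p₁ (k - m : ℕ) (hp₁ ▸ min_le_right _ _)
    (fun j => by
      rw [walk_succ]
      rcases stepSign_eq (e := e) (ε := ε) j with h | h <;> omega)
    (fun q _ => by
      rcases Nat.lt_or_ge q p₁ with h | h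
      · exact Or.inr h
      · left
        simp only [numValues_eq_numAccepted_add (e := e) (ε := ε) (A := A)]
        have := card_le_card (filter_subset_filter
          (fun j => ε (e j).1 = (e j).2 ∧ (e j).1 ∉ A) (range_subset_range.2 h))
        push_cast
        linarith)
    hR hRτ
  have hesc : #{r ∈ range p₁ | (∀ q, r < q → q ≤ τ → walk e ε r < walk e ε q) ∧
      walk e ε r + (k - m : ℕ) < walk e ε τ} ≤
      #{r ∈ range p' | ∃ τ, EscapesAt e N m (k - m) r τ ε} := by
    refine card_le_card fun r hr => ?_
    simp only [mem_filter, mem_range] at hr ⊢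
    exact ⟨by omega, τ, by omega, hτN, fun q hq => (hmin q hq).1,
      fun h => by omega, hr.2.1, hr.2.2⟩
  have hacc : numAccepted e ε A p₁ ≤ numAccepted e ε A p := numAccepted_mono (by omega)
  -- If `p' = 2k ≤ τ`, at most `m ≤ k` of these positions are samples, so at least `k` values are
  -- already present. If `τ < p'`, each position from `τ` to `p'` is paid for by the last count.
  have hcut : min k (numValues e ε p) ≤ numValues e ε p₁ +
      #{q ∈ range p' | m ≤ numSamples e ε q} := by
    rcases le_or_gt p' τ with h | h
    · have h1 : p₁ = p' := hp₁.trans (min_eq_left h)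
      rw [h1]
      rcases le_total p (2 * k) with h2 | h2
      · have : p' = p := hp'.trans (min_eq_left h2)
        rw [this]; omega
      · have h3 : p' = 2 * k := hp'.trans (min_eq_right h2)
        have h4 := numValues_add_numSamples (e := e) (ε := ε) p'
        have h5 := numSamples_mono (e := e) ε h
        omega
    · have h1 : p₁ = τ := hp₁.trans (min_eq_right h.le)
      rw [h1]
      have h2 : p' - τ ≤ #{q ∈ range p' | m ≤ numSamples e ε q} := by
        rw [← Nat.card_Ico]
        refine card_le_card fun q hq => ?_
        simp only [mem_filter, mem_range, mem_Ico] at hq ⊢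
        have := numSamples_mono (e := e) ε hq.1
        omega
      have h3 := numValues_add_numSamples (e := e) (ε := ε) τ
      have h4 := numValues_add_numSamples (e := e) (ε := ε) p
      have h5 := numSamples_mono (e := e) ε (show τ ≤ p by omega)
      clear hdef hRτ hR hesc
      omega
  have h6 := numAccepted_le_numValues (e := e) (ε := ε) (A := A) p₁
  omega

end FirstFit

/-! ### Averaging over the exchanges: the constant 44 -/

section Expectation

open Finset

variable {n k : ℕ} {e : ℕ → Fin n × Bool}

theorem card_le_two_pow (P : (Fin n → Bool) → Prop) [DecidablePred P] :
    (#{ε | P ε} : ℝ) ≤ 2 ^ n := by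
  have := card_filter_le (univ : Finset (Fin n → Bool)) P
  rw [card_univ, Fintype.card_fun, Fintype.card_bool, Fintype.card_fin] at this
  exact_mod_cast this

/-- Turns losses proportional to `min p (2k)` into relative losses. On average half of these
positions are values, and their number is at most `2k` and at most `numValues p`. -/
theorem two_pow_mul_le_four_mul_sum_min (p : ℕ) :
    (2 : ℝ) ^ n * min p (2 * k) ≤
      4 * ∑ ε : Fin n → Bool, ((min k (numValues e ε p) : ℕ) : ℝ) := by
  set p' := min p (2 * k) with hp'
  have h1 := two_mul_sum_numValues (e := e) p'
  have h2 : ∀ ε : Fin n → Bool, numValues e ε p' ≤ 2 * min k (numValues e ε p) := by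
    intro ε
    have h3 := numValues_add_numSamples (e := e) (ε := ε) p'
    have h4 := numValues_mono (e := e) ε (show p' ≤ p from min_le_left _ _)
    omega
  have h3 : ∑ ε : Fin n → Bool, (numValues e ε p' : ℤ) ≤
      ∑ ε, 2 * ((min k (numValues e ε p) : ℕ) : ℤ) :=
    sum_le_sum fun ε _ => by exact_mod_cast h2 ε
  rw [← mul_sum] at h3
  have h4 : (2 : ℤ) ^ n * p' ≤ 4 * ∑ ε : Fin n → Bool, ((min k (numValues e ε p) : ℕ) : ℤ) := by
    linarith
  have h5 : (2 : ℝ) ^ n * (p' : ℕ) ≤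
      4 * ∑ ε : Fin n → Bool, ((min k (numValues e ε p) : ℕ) : ℝ) := by exact_mod_cast h4
  simpa [hp'] using h5

theorem sum_range_inv_sq_le (M t : ℕ) :
    ∑ q ∈ range M with q + t < M, (((M : ℝ) - q) ^ 2)⁻¹ ≤ 2 / (t + 1) := by
  refine le_trans ?_ (sum_Ioo_inv_sq_le t (M + 1))
  have h1 : ∑ q ∈ range M with q + t < M, (((M : ℝ) - q) ^ 2)⁻¹ =
      ∑ x ∈ (range M |>.filter fun q => q + t < M).image (fun q => M - q), ((x : ℝ) ^ 2)⁻¹ := by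
    rw [sum_image]
    · refine sum_congr rfl fun q hq => ?_
      rw [Nat.cast_sub (by simp at hq; omega)]
    · intro a ha b hb hab
      simp at ha hb hab
      omega
  rw [h1]
  refine sum_le_sum_of_subset_of_nonneg ?_ fun _ _ _ => by positivity
  intro x hx
  simp only [mem_image, mem_filter, mem_range, mem_Ioo] at hx ⊢
  omega

/-- It is unlikely that `m` samples are seen much before time `2 * k`. -/
theorem sum_card_le_numSamples_le {N m p : ℕ} (he : Set.InjOn e (Set.Iio N)) (hpN : p ≤ N)
    (hp : p ≤ 2 * k) (hk : 44 < √(k : ℝ)) (hm : (k : ℝ) - 2 * √(k : ℝ) ≤ m) (hmk : m ≤ k) :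
    ∑ q ∈ range p, (#{ε : Fin n → Bool | m ≤ numSamples e ε q} : ℝ) ≤
      2 ^ n * (10 * (p / √(k : ℝ))) := by
  set s := √(k : ℝ) with hs
  have hs2 : s * s = k := Real.mul_self_sqrt (Nat.cast_nonneg k)
  have hs0 : 0 < s := by linarith
  have hcheb : ∀ q < p, q ≤ 2 * m → (#{ε : Fin n → Bool | m ≤ numSamples e ε q} : ℝ) *
      (2 * m - q) ^ 2 ≤ 2 ^ n * q := fun q hq hqm => by
    exact_mod_cast card_le_numSamples_mul_le he (by omega) hqm
  -- For `p ≤ k` every `q < p` is at distance at least `k/2` from `2m`, so Chebyshev gives `4/k` per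
  -- term. For `p > k` a total of `10√k` is enough, because `√k ≤ p/√k`.
  rcases le_or_gt p k with hpk | hpk
  · have h1 : ∀ q ∈ range p, (#{ε : Fin n → Bool | m ≤ numSamples e ε q} : ℝ) ≤
        2 ^ n * (10 / s) := by
      intro q hq
      rw [mem_range] at hq
      have hqk : (q : ℝ) ≤ k := by exact_mod_cast (hq.le.trans hpk)
      have h2 : (k : ℝ) / 2 ≤ 2 * m - q := by nlinarith
      have h3 := hcheb q hq (by
        have : (q : ℝ) ≤ 2 * m := by nlinarith
        exact_mod_cast this)
      have hk0 : (0 : ℝ) < k := by nlinarith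
      have h4 : ((k : ℝ) / 2) ^ 2 ≤ (2 * m - q) ^ 2 := pow_le_pow_left₀ (by positivity) h2 2
      have h5 : (#{ε : Fin n → Bool | m ≤ numSamples e ε q} : ℝ) * ((k : ℝ) / 2) ^ 2 ≤
          2 ^ n * k :=
        (mul_le_mul_of_nonneg_left h4 (by positivity)).trans
          (h3.trans (mul_le_mul_of_nonneg_left hqk (by positivity)))
      have h6 : (#{ε : Fin n → Bool | m ≤ numSamples e ε q} : ℝ) ≤ 2 ^ n * (4 / k) := by
        rw [← le_div_iff₀ (by positivity)] at h5
        refine h5.trans (le_of_eq ?_)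
        field_simp
        ring
      refine h6.trans (mul_le_mul_of_nonneg_left ?_ (by positivity))
      rw [div_le_div_iff₀ hk0 hs0]
      nlinarith
    refine (sum_le_sum h1).trans (le_of_eq ?_)
    rw [sum_const, card_range, nsmul_eq_mul]
    ring
  -- Times within `√k` of `2m` or later are bounded trivially: there are at most `2k - 2m + t ≤ 6√k`
  -- of them. The earlier ones have a Chebyshev tail of at most `4k/(t + 1) ≤ 4√k`.
  · set t := ⌈s⌉₊ with ht
    have ht1 : s ≤ t := Nat.le_ceil s
    have ht2 : (t : ℝ) < s + 1 := Nat.ceil_lt_add_one hs0.le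
    have h1 : ∀ q ∈ range p, (#{ε : Fin n → Bool | m ≤ numSamples e ε q} : ℝ) ≤
        2 ^ n * ((if 2 * m ≤ q + t then 1 else 0) +
          if q + t < 2 * m then 2 * k * ((((2 * m : ℕ) : ℝ) - q) ^ 2)⁻¹ else 0) := by
      intro q hq
      rw [mem_range] at hq
      by_cases hqt : q + t < 2 * m
      · rw [if_neg (by omega), if_pos hqt, zero_add]
        have h3 := hcheb q hq (by omega)
        have h4 : (0 : ℝ) < ((2 * m : ℕ) : ℝ) - q := by
          rw [sub_pos]; exact_mod_cast (by omega)
        have hqk : (q : ℝ) ≤ 2 * k := by exact_mod_cast (by omega)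
        rw [← mul_assoc, ← div_eq_mul_inv, le_div_iff₀ (by positivity)]
        push_cast
        exact h3.trans (mul_le_mul_of_nonneg_left hqk (by positivity))
      · rw [if_pos (by omega), if_neg hqt, add_zero, mul_one]
        exact card_le_two_pow _
    refine (sum_le_sum h1).trans ?_
    rw [← mul_sum, sum_add_distrib]
    refine mul_le_mul_of_nonneg_left ?_ (by positivity)
    have h2 : ∑ q ∈ range p, (if 2 * m ≤ q + t then (1 : ℝ) else 0) ≤ 6 * s := by
      rw [← sum_filter, sum_const, nsmul_eq_mul, mul_one]
      have h3 : #{q ∈ range p | 2 * m ≤ q + t} ≤ 2 * k - (2 * m - t) := by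
        rw [← Nat.card_Ico]
        refine card_le_card fun q hq => ?_
        simp only [mem_filter, mem_range, mem_Ico] at hq ⊢
        omega
      have h4 : (#{q ∈ range p | 2 * m ≤ q + t} : ℝ) + 2 * m ≤ 2 * k + t := by
        exact_mod_cast (by omega)
      linarith
    have h3 : ∑ q ∈ range p, (if q + t < 2 * m then
        2 * (k : ℝ) * ((((2 * m : ℕ) : ℝ) - q) ^ 2)⁻¹ else 0) ≤ 4 * s := by
      rw [← sum_filter, ← mul_sum]
      have h4 : ∑ q ∈ range p with q + t < 2 * m, ((((2 * m : ℕ) : ℝ) - q) ^ 2)⁻¹ ≤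
          2 / (t + 1) := by
        refine le_trans (sum_le_sum_of_subset_of_nonneg ?_ fun _ _ _ => by positivity)
          (sum_range_inv_sq_le (2 * m) t)
        intro q hq
        simp only [mem_filter, mem_range] at hq ⊢
        omega
      refine (mul_le_mul_of_nonneg_left h4 (by positivity)).trans ?_
      rw [mul_div_assoc', div_le_iff₀ (by positivity)]
      nlinarith
    have h4 : s ≤ p / s := by
      rw [le_div_iff₀ hs0, hs2]
      exact_mod_cast hpk.le
    linarith

open Classical in
/-- On average, first-fit accepts almost as many of the top values as any set of at most `k`
elements contains. -/
theorem sum_min_numValues_le {N m p : ℕ} (he : Set.InjOn e (Set.Iio N))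
    (hsurj : ∀ x, ∃ j < N, e j = x) (hp : p ≤ N) (hk : 44 < √(k : ℝ))
    (hm : (k : ℝ) - 2 * √(k : ℝ) ≤ m) (hm' : (m : ℝ) < k - 2 * √(k : ℝ) + 1)
    (A : (Fin n → Bool) → Finset (Fin n)) (σ : (Fin n → Bool) → Fin n → Fin k)
    (hA : ∀ ε, IsFirstFit e ε N m (A ε) (σ ε)) :
    (1 - 44 / √(k : ℝ)) * ∑ ε : Fin n → Bool, ((min k (numValues e ε p) : ℕ) : ℝ) ≤
      ∑ ε, (numAccepted e ε (A ε) p : ℝ) := by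
  have hs2 : √(k : ℝ) * √(k : ℝ) = k := Real.mul_self_sqrt (Nat.cast_nonneg k)
  set s := √(k : ℝ) with hs
  have hmk : m < k := by
    have : (m : ℝ) < k := by linarith
    exact_mod_cast this
  have hm0 : 0 < m := by
    have : (0 : ℝ) < m := by nlinarith
    exact_mod_cast this
  set p' := min p (2 * k) with hp'
  have h1 : ∑ ε : Fin n → Bool, ((min k (numValues e ε p) : ℕ) : ℝ) ≤
      ∑ ε, (numAccepted e ε (A ε) p : ℝ) +
      ∑ ε, (#{r ∈ range p' | ∃ τ, EscapesAt e N m (k - m) r τ ε} : ℝ) +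
      ∑ ε, (#{q ∈ range p' | m ≤ numSamples e ε q} : ℝ) := by
    rw [← sum_add_distrib, ← sum_add_distrib]
    exact sum_le_sum fun ε _ => by
      exact_mod_cast (hA ε).min_numValues_le he hsurj hm0 hmk.le hp
  have h2 : ∑ ε, (#{r ∈ range p' | ∃ τ, EscapesAt e N m (k - m) r τ ε} : ℝ) ≤
      2 ^ n * (p' / s) := by
    have h3 : ∑ ε, (#{r ∈ range p' | ∃ τ, EscapesAt e N m (k - m) r τ ε} : ℝ) =
        ∑ r ∈ range p', (#{ε | ∃ τ, EscapesAt e N m (k - m) r τ ε} : ℝ) := by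
      simp only [card_filter, Nat.cast_sum]
      exact sum_comm
    -- The rounding in `m` leaves `k - m > 2√k - 1 ≥ √k`.
    have h4 : ∀ r ∈ range p', (#{ε | ∃ τ, EscapesAt e N m (k - m) r τ ε} : ℝ) ≤ 2 ^ n / s := by
      intro r _
      rw [le_div_iff₀ (by linarith)]
      have h5 : (#{ε | ∃ τ, EscapesAt e N m (k - m) r τ ε} : ℝ) * ((k - m : ℕ) : ℝ) ≤ 2 ^ n := by
        exact_mod_cast card_escapes_mul_le (m := m) (h := k - m) (r := r) he
      refine le_trans (mul_le_mul_of_nonneg_left ?_ (by positivity)) h5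
      rw [Nat.cast_sub hmk.le]
      linarith
    rw [h3]
    refine (sum_le_sum h4).trans (le_of_eq ?_)
    rw [sum_const, card_range, nsmul_eq_mul]
    ring
  have h3 : ∑ ε, (#{q ∈ range p' | m ≤ numSamples e ε q} : ℝ) ≤ 2 ^ n * (10 * (p' / s)) := by
    refine le_trans (le_of_eq ?_) (sum_card_le_numSamples_le he ((min_le_left _ _).trans hp)
      (min_le_right p (2 * k)) hk hm hmk.le)
    simp only [card_filter, Nat.cast_sum]
    exact sum_comm
  have h4 : (2 : ℝ) ^ n * p' ≤ 4 * ∑ ε : Fin n → Bool, ((min k (numValues e ε p) : ℕ) : ℝ) := by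
    have := two_pow_mul_le_four_mul_sum_min (e := e) (k := k) p
    exact_mod_cast this
  -- The escapes cost `1/√k` and the early times `10/√k` per position; the factor 4 of `h4` makes
  -- this 44.
  have h5 : (2 : ℝ) ^ n * (11 * (p' / s)) ≤
      44 / s * ∑ ε : Fin n → Bool, ((min k (numValues e ε p) : ℕ) : ℝ) := by
    have : (2 : ℝ) ^ n * (11 * (p' / s)) = 11 / s * (2 ^ n * p') := by ring
    rw [this]
    refine (mul_le_mul_of_nonneg_left h4 (div_nonneg (by norm_num) (by linarith))).trans
      (le_of_eq ?_)
    ring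
  linarith

theorem sum_range_ite_eq_sum {N : ℕ} (he : Set.InjOn e (Set.Iio N))
    (hsurj : ∀ x, ∃ j < N, e j = x) (ε : Fin n → Bool) (A : Finset (Fin n))
    (f : Fin n × Bool → ℝ) :
    ∑ j ∈ range N, (if ε (e j).1 = (e j).2 ∧ (e j).1 ∈ A then f (e j) else 0) =
      ∑ i ∈ A, f (i, ε i) := by
  rw [← sum_filter]
  refine sum_bij (fun j _ => (e j).1) (fun j hj => (mem_filter.1 hj).2.2) ?_ ?_ ?_
  · intro j hj j' hj' h
    simp only [mem_filter, mem_range] at hj hj'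
    refine he hj.1 hj'.1 (Prod.ext h ?_)
    rw [← hj.2.1, ← hj'.2.1, h]
  · intro i hi
    obtain ⟨j, hj, hji⟩ := hsurj (i, ε i)
    exact ⟨j, by simp [hj, hji, hi], by rw [hji]⟩
  · intro j hj
    rw [(mem_filter.1 hj).2.1]

/-- The competitive ratio of first-fit, averaged over the exchanges of samples and values, when
the weights decrease along the positions. -/
theorem sum_weight_le {N m : ℕ} (he : Set.InjOn e (Set.Iio N))
    (hsurj : ∀ x, ∃ j < N, e j = x) (hk : 44 < √(k : ℝ))
    (hm : (k : ℝ) - 2 * √(k : ℝ) ≤ m) (hm' : (m : ℝ) < k - 2 * √(k : ℝ) + 1)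
    (A S : (Fin n → Bool) → Finset (Fin n)) (σ : (Fin n → Bool) → Fin n → Fin k)
    (hA : ∀ ε, IsFirstFit e ε N m (A ε) (σ ε)) (hS : ∀ ε, #(S ε) ≤ k)
    (f : Fin n × Bool → ℝ) (hf : ∀ x, 0 ≤ f x) (hanti : ∀ j, j + 1 < N → f (e (j + 1)) ≤ f (e j)) :
    (1 - 44 / √(k : ℝ)) * ∑ ε, ∑ i ∈ S ε, f (i, ε i) ≤ ∑ ε, ∑ i ∈ A ε, f (i, ε i) := by
  set c := 1 - 44 / √(k : ℝ) with hc
  have hc0 : 0 ≤ c := by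
    rw [hc, sub_nonneg, div_le_one (by linarith)]
    exact hk.le
  have h1 := sum_mul_nonneg_of_antitone N (fun j => f (e j))
    (fun j => ∑ ε : Fin n → Bool, ((if ε (e j).1 = (e j).2 ∧ (e j).1 ∈ A ε then 1 else 0) -
      c * (if ε (e j).1 = (e j).2 ∧ (e j).1 ∈ S ε then 1 else 0))) (fun j _ => hf _) hanti ?_
  · have h2 : ∀ B : (Fin n → Bool) → Finset (Fin n), ∑ ε, ∑ i ∈ B ε, f (i, ε i) =
        ∑ j ∈ range N, ∑ ε : Fin n → Bool,
          (if ε (e j).1 = (e j).2 ∧ (e j).1 ∈ B ε then 1 else 0) * f (e j) := by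
      intro B
      rw [sum_comm]
      refine sum_congr rfl fun ε _ => ?_
      rw [← sum_range_ite_eq_sum he hsurj]
      refine sum_congr rfl fun j _ => ?_
      split_ifs <;> simp
    rw [h2, h2, ← sub_nonneg, mul_sum, ← sum_sub_distrib]
    convert h1 using 2 with j
    rw [sum_mul, mul_sum, ← sum_sub_distrib]
    refine sum_congr rfl fun ε _ => ?_
    ring
  · intro p hp
    have h2 : ∀ B : (Fin n → Bool) → Finset (Fin n), ∑ j ∈ range p, ∑ ε : Fin n → Bool,
        (if ε (e j).1 = (e j).2 ∧ (e j).1 ∈ B ε then (1 : ℝ) else 0) =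
        ∑ ε, (numAccepted e ε (B ε) p : ℝ) := by
      intro B
      rw [sum_comm]
      simp [numAccepted]
    simp only [sum_sub_distrib, ← mul_sum]
    rw [h2, h2, sub_nonneg]
    -- The benchmark `S ε` has at most `min k (numValues p)` elements with values among the top `p`
    -- positions.
    refine le_trans (mul_le_mul_of_nonneg_left (sum_le_sum fun ε _ => ?_) hc0)
      (sum_min_numValues_le he hsurj hp hk hm hm' A σ hA)
    exact_mod_cast le_min ((numAccepted_le_card he hp).trans (hS ε)) (numAccepted_le_numValues p)

end Expectation

/-! ### From thresholds on distinct keys to ranks in the sorted list -/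

section Keys

open Finset

variable {n k : ℕ} {α : Type} [LinearOrder α]

/-- A finite family of distinct keys can be enumerated in decreasing order. -/
theorem exists_descending_enumeration (hn : 0 < n) (κ : Fin n × Bool → α)
    (hκ : Function.Injective κ) : ∃ e : ℕ → Fin n × Bool, Set.InjOn e (Set.Iio (2 * n)) ∧
      (∀ x, ∃ j < 2 * n, e j = x) ∧ ∀ j j', j < j' → j' < 2 * n → κ (e j') < κ (e j) := by
  have hcard : Fintype.card (Fin n × Bool) = 2 * n := by simp [mul_comm]
  let E : Fin (2 * n) ≃ Fin n × Bool := (Fintype.equivFinOfCardEq hcard).symm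
  let g : Fin (2 * n) → αᵒᵈ := fun j => OrderDual.toDual (κ (E j))
  have hg : Function.Injective g := OrderDual.toDual.injective.comp (hκ.comp E.injective)
  have hsm : StrictMono (g ∘ Tuple.sort g) :=
    (Tuple.monotone_sort g).strictMono_of_injective (hg.comp (Tuple.sort g).injective)
  let e : ℕ → Fin n × Bool := fun j =>
    if h : j < 2 * n then E (Tuple.sort g ⟨j, h⟩) else (⟨0, hn⟩, true)
  have he : ∀ j (h : j < 2 * n), e j = E (Tuple.sort g ⟨j, h⟩) := fun j h => dif_pos h
  refine ⟨e, ?_, ?_, ?_⟩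
  · intro j hj j' hj' h
    rw [he j hj, he j' hj'] at h
    exact congrArg Fin.val ((Tuple.sort g).injective (E.injective h))
  · intro x
    refine ⟨(Tuple.sort g).symm (E.symm x), Fin.is_lt _, ?_⟩
    rw [he _ (Fin.is_lt _)]
    simp
  · intro j j' hjj' hj'
    rw [he j' hj', he j (by omega)]
    exact hsm (show (⟨j, by omega⟩ : Fin (2 * n)) < ⟨j', hj'⟩ from hjj')

theorem numSamples_eq_card {κ : Fin n × Bool → α} {e : ℕ → Fin n × Bool} {N : ℕ}
    (he : Set.InjOn e (Set.Iio N)) (hsurj : ∀ x, ∃ j < N, e j = x)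
    (hanti : ∀ j j', j < j' → j' < N → κ (e j') < κ (e j)) (ε : Fin n → Bool) {j : ℕ} (hj : j < N)
    (hv : ε (e j).1 = (e j).2) :
    numSamples e ε j = #{i | κ (e j) ≤ κ (i, !ε i)} := by
  have hsample : ∀ j', ε (e j').1 ≠ (e j').2 → e j' = ((e j').1, !ε (e j').1) := fun j' h => by
    refine Prod.ext rfl ?_
    revert h
    cases ε (e j').1 <;> cases (e j').2 <;> simp
  refine card_bij (fun j' _ => (e j').1) ?_ ?_ ?_
  · intro j' hj'
    simp only [mem_filter, mem_range, mem_univ, true_and] at hj' ⊢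
    rw [← hsample j' hj'.2]
    exact (hanti j' j hj'.1 hj).le
  · intro a ha b hb hab
    simp only [mem_filter, mem_range] at ha hb
    refine he (show a < N by omega) (show b < N by omega) ?_
    rw [hsample a ha.2, hsample b hb.2, hab]
  · intro i hi
    simp only [mem_filter, mem_univ, true_and] at hi
    obtain ⟨j', hj', hji⟩ := hsurj (i, !ε i)
    have hne : ε (e j').1 ≠ (e j').2 := by rw [hji]; simp
    refine ⟨j', ?_, by rw [hji]⟩
    simp only [mem_filter, mem_range]
    refine ⟨?_, hne⟩
    rcases lt_trichotomy j' j with h | h | h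
    · exact h
    · exact absurd (h ▸ hv) hne
    · rw [← hji] at hi
      exact absurd (hanti j j' h hj') hi.not_gt

variable [OrderBot α]

/-- In a decreasing list no entry after one below `y` can reach `y`. The condition `⊥ < y` accounts
for indices beyond the end, where the default is `⊥`. -/
theorem List.getD_bot_lt_iff (L : List α) (hL : L.Pairwise fun a b => b ≤ a) (j : ℕ) (y : α) :
    L.getD j ⊥ < y ↔ ⊥ < y ∧ L.countP (fun a => decide (y ≤ a)) ≤ j := by
  induction L generalizing j with
  | nil => simp
  | cons a L ih =>
    obtain ⟨ha, hL⟩ := List.pairwise_cons.1 hL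
    have hzero : a < y → L.countP (fun a => decide (y ≤ a)) = 0 := fun h => by
      rw [List.countP_eq_zero]
      intro b hb
      simpa using (ha b hb).trans_lt h
    rw [List.countP_cons]
    rcases le_or_gt y a with h | h
    · rcases j with _ | j
      · simp [h]
      · simpa [h] using ih hL j
    · have hbot : ⊥ < y := bot_le.trans_lt h
      rcases j with _ | j
      · simp [hbot, hzero h, h]
      · have := ih hL j
        rw [hzero h] at this ⊢
        simp only [List.getD_cons_succ, this]
        simp [h.not_ge]

/-- The `(j+1)`-st largest entry lies below `y` iff at most `j` entries are at least `y`. -/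
theorem descending_lt_iff (x : Fin n → α) (j : ℕ) (y : α) :
    descending x j < y ↔ ⊥ < y ∧ #{i | y ≤ x i} ≤ j := by
  unfold descending
  rw [List.getD_bot_lt_iff _ (Multiset.pairwise_sort _ _)]
  have h : List.countP (fun a => decide (y ≤ a))
      ((Multiset.map x univ.val).sort (fun a b => b ≤ a)) = #{i | y ≤ x i} := by
    rw [← Multiset.coe_countP, Multiset.sort_eq, Multiset.countP_map]
    rfl
  rw [h]

/-- The slots that are eligible for each element in the Rehearsal Algorithm with sample keys `x`
and value keys `y`. -/
def eligibleSlots (k : ℕ) (x y : Fin n → α) (i : Fin n) (j : Fin k) : Bool :=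
  decide (thresholds k x j < y i)

/-- Only ranks matter: a key above `⊥` beats the threshold of a slot iff few enough samples precede
it. All elements must arrive, since `IsFirstFit` speaks of every value. -/
theorem exists_isFirstFit {κ : Fin n × Bool → α} (hbot : ∀ x, ⊥ < κ x) {e : ℕ → Fin n × Bool}
    {N : ℕ} (he : Set.InjOn e (Set.Iio N)) (hsurj : ∀ x, ∃ j < N, e j = x)
    (hanti : ∀ j j', j < j' → j' < N → κ (e j') < κ (e j)) (ε : Fin n → Bool) (hk : 0 < k)
    (l : List (Fin n)) (hl : l.Nodup) (hmem : ∀ i, i ∈ l) :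
    ∃ σ : Fin n → Fin k, IsFirstFit e ε N (numTop k)
      (firstFit (eligibleSlots k (fun i => κ (i, !ε i)) (fun i => κ (i, ε i))) univ l) σ := by
  obtain ⟨σ, -, h2, h3, h4⟩ := exists_slot_firstFit hk
    (eligibleSlots k (fun i => κ (i, !ε i)) (fun i => κ (i, ε i))) l hl univ
  have hE : ∀ j < N, ε (e j).1 = (e j).2 → ∀ c : Fin k,
      (eligibleSlots k (fun i => κ (i, !ε i)) (fun i => κ (i, ε i)) (e j).1 c = true ↔
        numSamples e ε j ≤ min (c : ℕ) (numTop k - 1)) := by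
    intro j hj hv c
    rw [eligibleSlots, decide_eq_true_eq, thresholds, descending_lt_iff,
      numSamples_eq_card he hsurj hanti ε hj hv, and_iff_right (hbot _), hv]
  exact ⟨σ, h2, fun j hj hv hA => (hE j hj hv _).1 (h3 _ hA).2,
    fun j hj hv c hc hfree => h4 _ (hmem _) c (mem_univ _) ((hE j hj hv c).2 hc) hfree⟩

theorem exists_optValue_eq (v : Fin n → ℝ≥0) : ∃ S : Finset (Fin n), #S ≤ k ∧
    optValue (uniformFeasible n k) v = ∑ i ∈ S, (v i : ℝ≥0∞) := by
  obtain ⟨S, hS, hmax⟩ := exists_max_image (univ.filter fun S : Finset (Fin n) => #S ≤ k)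
    (fun S => ∑ i ∈ S, (v i : ℝ≥0∞)) ⟨∅, by simp⟩
  simp only [mem_filter, mem_univ, true_and] at hS hmax
  refine ⟨S, hS, le_antisymm (iSup₂_le fun T hT => hmax T hT) ?_⟩
  exact le_iSup₂ (f := fun (S : Finset (Fin n)) (_ : S ∈ uniformFeasible n k) =>
    ∑ i ∈ S, (v i : ℝ≥0∞)) S hS

/-- The competitive ratio of the Rehearsal Algorithm, averaged over the exchanges of samples and
values, for distinct keys. -/
theorem mul_sum_optValue_le (hk : 44 < √(k : ℝ)) (num : α → ℝ≥0) (hnum : Monotone num)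
    (κ : Fin n × Bool → α) (hκ : Function.Injective κ) (hbot : ∀ x, ⊥ < κ x)
    (l : (Fin n → Bool) → List (Fin n)) (hl : ∀ ε, (l ε).Nodup) (hmem : ∀ ε i, i ∈ l ε) :
    ENNReal.ofReal (1 - 44 / √(k : ℝ)) *
        ∑ ε : Fin n → Bool, optValue (uniformFeasible n k) (fun i => num (κ (i, ε i))) ≤
      ∑ ε : Fin n → Bool, ∑ i ∈ firstFit (eligibleSlots k (fun i => κ (i, !ε i)) (fun i => κ (i, ε i)))
        univ (l ε), (num (κ (i, ε i)) : ℝ≥0∞) := by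
  choose S hS hopt using fun ε : Fin n → Bool =>
    exists_optValue_eq (k := k) (fun i => num (κ (i, ε i)))
  -- The enumeration needs an element for its junk values beyond `2n`.
  rcases Nat.eq_zero_or_pos n with rfl | hn
  · simp [hopt, Finset.eq_empty_of_isEmpty]
  have hs2 : √(k : ℝ) * √(k : ℝ) = k := Real.mul_self_sqrt (Nat.cast_nonneg k)
  have hk0 : 0 < k := by
    have : (0 : ℝ) < k := by nlinarith
    exact_mod_cast this
  obtain ⟨e, he, hsurj, hanti⟩ := exists_descending_enumeration hn κ hκ
  choose σ hσ using fun ε => exists_isFirstFit hbot he hsurj hanti ε hk0 (l ε) (hl ε) (hmem ε)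
  -- The upper bound on the rounded `numTop k` needs `k - 2√k ≥ 0`, as the natural ceiling truncates
  -- at 0.
  have h1 := sum_weight_le he hsurj hk (Nat.le_ceil _)
    (Nat.ceil_lt_add_one (by nlinarith)) _ S σ hσ hS (fun x => (num (κ x) : ℝ))
    (fun _ => NNReal.coe_nonneg _)
    (fun j hj => NNReal.coe_le_coe.2 (hnum (hanti j (j + 1) (by omega) hj).le))
  have hc0 : 0 ≤ 1 - 44 / √(k : ℝ) := by
    rw [sub_nonneg, div_le_one (by linarith)]
    exact hk.le
  simp only [hopt]
  rw [ENNReal.ofReal]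
  norm_cast
  rw [← NNReal.coe_le_coe]
  push_cast
  rw [Real.coe_toNNReal _ hc0]
  exact h1

end Keys

/-! ### Exchanging samples and values preserves the measure -/

section Swap

variable {n : ℕ} {X : Type}

/-- Keep the pairs `(p.1 i, p.2 i)` with `ε i = true` and exchange the others. -/
def swapPairs (ε : Fin n → Bool) (p : (Fin n → X) × (Fin n → X)) : (Fin n → X) × (Fin n → X) :=
  (fun i => if ε i then p.1 i else p.2 i, fun i => if ε i then p.2 i else p.1 i)

/-- Regrouped as a product over `i` of the symmetric measures `μ i ⊗ μ i`, the map acts on each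
coordinate as the identity or the swap. -/
theorem measurePreserving_swapPairs [MeasurableSpace X] (μ : Fin n → Measure X)
    [∀ i, IsProbabilityMeasure (μ i)] (ε : Fin n → Bool) :
    MeasurePreserving (swapPairs ε) ((Measure.pi μ).prod (Measure.pi μ))
      ((Measure.pi μ).prod (Measure.pi μ)) := by
  have hE := measurePreserving_arrowProdEquivProdArrow X X (Fin n) μ μ
  have h1 : MeasurePreserving (fun (a : Fin n → X × X) i => (if ε i then id else Prod.swap) (a i))
      (Measure.pi fun i => (μ i).prod (μ i)) (Measure.pi fun i => (μ i).prod (μ i)) := by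
    refine measurePreserving_pi _ _ fun i => ?_
    split_ifs
    · exact MeasurePreserving.id _
    · exact Measure.measurePreserving_swap
  convert hE.comp (h1.comp (hE.symm _)) using 1
  ext p i <;> cases h : ε i <;>
    simp [swapPairs, h, MeasurableEquiv.arrowProdEquivProdArrow, Equiv.arrowProdEquivProdArrow]

theorem prod_diagonal_eq_zero [MeasurableSpace X] [MeasurableEq X] (μ ν : Measure X)
    [SFinite ν] [NullSingletonClass ν] : (μ.prod ν) (Set.diagonal X) = 0 := by
  rw [Measure.measure_prod_null measurableSet_diagonal]
  refine Filter.Eventually.of_forall fun x => ?_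
  have : Prod.mk x ⁻¹' Set.diagonal X = {x} := by
    ext y; simp [eq_comm]
  simp [this]

theorem ae_ne_of_null_singleton [MeasurableSpace X] [MeasurableEq X] (μ : Fin n → Measure X)
    [∀ i, IsProbabilityMeasure (μ i)] [∀ i, NullSingletonClass (μ i)] (i j : Fin n) :
    ∀ᵐ p ∂(Measure.pi μ).prod (Measure.pi μ), p.1 i ≠ p.2 j := by
  have h := (measurePreserving_eval μ i).prod (measurePreserving_eval μ j)
  exact h.quasiMeasurePreserving.ae (p := fun p => p.1 ≠ p.2)
    (by simpa [ae_iff, Set.diagonal] using prod_diagonal_eq_zero (μ i) (μ j))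

theorem ae_snd_ne_of_null_singleton [MeasurableSpace X] (μ : Fin n → Measure X)
    [∀ i, IsProbabilityMeasure (μ i)] [∀ i, NullSingletonClass (μ i)] (i : Fin n) (x : X) :
    ∀ᵐ p ∂(Measure.pi μ).prod (Measure.pi μ), p.2 i ≠ x := by
  have h := (measurePreserving_eval μ i).comp
    (measurePreserving_snd (μ := Measure.pi μ) (ν := Measure.pi μ))
  exact h.quasiMeasurePreserving.ae (p := fun y => y ≠ x) (by simp [ae_iff])

end Swap

/-! ### Feasibility and the competitive ratio for general keys -/

section Competitive

open Finset

variable {n k : ℕ}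

theorem card_firstFit_le (hk : 0 < k) (E : Fin n → Fin k → Bool) (l : List (Fin n))
    (hl : l.Nodup) (S : Finset (Fin k)) : #(firstFit E S l) ≤ k := by
  obtain ⟨σ, -, hinj, -⟩ := exists_slot_firstFit hk E l hl S
  simpa using card_le_card_of_injOn (t := univ) σ (by simp) hinj

theorem accepted_rehearsal {R α : Type} [LinearOrder α] [OrderBot α]
    (sKey vKey : R → Fin n → ℝ≥0 → α) (r : R) (s v : Fin n → ℝ≥0) (l : List (Fin n)) :
    (rehearsal n k sKey vKey).accepted r s v l =
      firstFit (eligibleSlots k (fun i => sKey r i (s i)) (fun i => vKey r i (v i))) univ l :=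
  acceptedFrom_rehearsal sKey vKey r v _ l univ

theorem isFeasible_rehearsal {R α : Type} [LinearOrder α] [OrderBot α] (hk : 0 < k)
    (sKey vKey : R → Fin n → ℝ≥0 → α) :
    (rehearsal n k sKey vKey).IsFeasible (uniformFeasible n k) := fun r s v l hl => by
  rw [accepted_rehearsal]
  exact card_firstFit_le hk _ l hl _

theorem measurable_optValue (J : Set (Finset (Fin n))) :
    Measurable (optValue J : (Fin n → ℝ≥0) → ℝ≥0∞) :=
  Measurable.iSup fun _ => Measurable.iSup fun _ =>
    Finset.measurable_sum _ fun i _ => (measurable_pi_apply i).coe_nnreal_ennreal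

/-- The accepted set depends on the keys only through this finite table. Counting comparisons
instead of sorting makes it measurable without any measurable structure on `α`. -/
theorem measurable_eligibleSlots {Ω α : Type} [MeasurableSpace Ω] [LinearOrder α] [OrderBot α]
    {x y : Ω → Fin n → α} (hle : ∀ i j, MeasurableSet {ω | y ω i ≤ x ω j})
    (hbot : ∀ i, MeasurableSet {ω | ⊥ < y ω i}) :
    Measurable fun ω => eligibleSlots k (x ω) (y ω) := by
  refine measurable_pi_iff.2 fun i => measurable_pi_iff.2 fun j => ?_
  refine measurable_to_bool ?_
  have h : (fun ω => eligibleSlots k (x ω) (y ω) i j) ⁻¹' {true} =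
      {ω | ⊥ < y ω i} ∩ {ω | ∑ i', (if y ω i ≤ x ω i' then 1 else 0) ≤
        min (j : ℕ) (numTop k - 1)} := by
    ext ω
    simp only [eligibleSlots, thresholds, Set.mem_preimage, Set.mem_singleton_iff,
      decide_eq_true_eq, descending_lt_iff, card_filter, Set.mem_inter_iff, Set.mem_ofPred_eq]
  rw [h]
  refine (hbot i).inter (measurableSet_le ?_ measurable_const)
  exact Finset.measurable_sum _ fun i' _ => Measurable.ite (hle i i') measurable_const
    measurable_const

/-- A rehearsal algorithm has competitive ratio `1 - 44 / √k` if exchanging the coins of a sample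
and a value amounts to exchanging their keys, and if the keys are almost surely distinct. -/
theorem hasCompetitiveRatio_rehearsal {R α : Type} [LinearOrder α] [OrderBot α]
    [MeasurableSpace R] (P : Measure R) [IsProbabilityMeasure P] (D : Fin n → Measure ℝ≥0)
    [∀ i, IsProbabilityMeasure (D i)] (hk : 44 < √(k : ℝ)) (sKey vKey : R → Fin n → ℝ≥0 → α)
    (num : α → ℝ≥0) (hnum : Monotone num) (hnumv : ∀ r i x, num (vKey r i x) = x)
    (swapR : (Fin n → Bool) → R → R) (hswapR : ∀ ε, MeasurePreserving (swapR ε) P P)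
    (hs : ∀ ε r i x, sKey (swapR ε r) i x = if ε i then sKey r i x else vKey r i x)
    (hv : ∀ ε r i x, vKey (swapR ε r) i x = if ε i then vKey r i x else sKey r i x)
    (hle : ∀ i j, MeasurableSet {ω : R × (Fin n → ℝ≥0) × (Fin n → ℝ≥0) |
      vKey ω.1 i (ω.2.2 i) ≤ sKey ω.1 j (ω.2.1 j)})
    (hbot : ∀ i, MeasurableSet {ω : R × (Fin n → ℝ≥0) × (Fin n → ℝ≥0) |
      ⊥ < vKey ω.1 i (ω.2.2 i)})
    (hne : ∀ i j, ∀ᵐ ω ∂P.prod ((Measure.pi D).prod (Measure.pi D)),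
      sKey ω.1 i (ω.2.1 i) ≠ vKey ω.1 j (ω.2.2 j))
    (hne_bot : ∀ i, ∀ᵐ ω ∂P.prod ((Measure.pi D).prod (Measure.pi D)),
      vKey ω.1 i (ω.2.2 i) ≠ ⊥) :
    (rehearsal n k sKey vKey).HasCompetitiveRatio (uniformFeasible n k) P D
      (ENNReal.ofReal (1 - 44 / √(k : ℝ))) := by
  intro order
  set Q := P.prod ((Measure.pi D).prod (Measure.pi D)) with hQ
  let Φ : (Fin n → Bool) → R × (Fin n → ℝ≥0) × (Fin n → ℝ≥0) →
    R × (Fin n → ℝ≥0) × (Fin n → ℝ≥0) := fun ε ω => (swapR ε ω.1, swapPairs ε ω.2)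
  have hΦ : ∀ ε, MeasurePreserving (Φ ε) Q Q := fun ε =>
    (hswapR ε).prod (measurePreserving_swapPairs D ε)
  let x : R × (Fin n → ℝ≥0) × (Fin n → ℝ≥0) → Fin n → α := fun ω i => sKey ω.1 i (ω.2.1 i)
  let y : R × (Fin n → ℝ≥0) × (Fin n → ℝ≥0) → Fin n → α := fun ω i => vKey ω.1 i (ω.2.2 i)
  let κ : R × (Fin n → ℝ≥0) × (Fin n → ℝ≥0) → Fin n × Bool → α := fun ω z =>
    if z.2 then y ω z.1 else x ω z.1
  have hx : ∀ ε ω i, x (Φ ε ω) i = κ ω (i, !ε i) := by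
    intro ε ω i
    cases h : ε i <;> simp [x, y, κ, Φ, hs, swapPairs, h]
  have hy : ∀ ε ω i, y (Φ ε ω) i = κ ω (i, ε i) := by
    intro ε ω i
    cases h : ε i <;> simp [x, y, κ, Φ, hv, swapPairs, h]
  let opt : R × (Fin n → ℝ≥0) × (Fin n → ℝ≥0) → ℝ≥0∞ := fun ω =>
    optValue (uniformFeasible n k) ω.2.2
  let rew : R × (Fin n → ℝ≥0) × (Fin n → ℝ≥0) → Equiv.Perm (Fin n) → ℝ≥0∞ := fun ω π =>
    ∑ i ∈ firstFit (eligibleSlots k (x ω) (y ω)) univ (List.ofFn π), (ω.2.2 i : ℝ≥0∞)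
  have hopt : Measurable opt := (measurable_optValue _).comp (by fun_prop)
  -- The infimum over the finitely many orders is measurable and lies below the reward of any
  -- adversary, measurable or not.
  have hrew : Measurable fun ω => ⨅ π, rew ω π := by
    refine Measurable.iInf fun π => ?_
    have h1 : ∀ ω, rew ω π = ∑ i, if i ∈ firstFit (eligibleSlots k (x ω) (y ω)) univ (List.ofFn π)
        then (ω.2.2 i : ℝ≥0∞) else 0 := fun ω => by simp [rew]
    simp only [h1]
    refine Finset.measurable_sum _ fun i _ => Measurable.ite ?_ ?_ measurable_const
    · exact measurable_eligibleSlots hle hbot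
        (MeasurableSet.of_discrete (s := {E | i ∈ firstFit E univ (List.ofFn π)}))
    · exact ((measurable_pi_apply i).comp (by fun_prop)).coe_nnreal_ennreal
  have hgood : ∀ᵐ ω ∂Q, Function.Injective (κ ω) ∧ ∀ z, ⊥ < κ ω z := by
    have h1 : ∀ᵐ ω ∂Q, ∀ ε : Fin n → Bool, ∀ i j, x (Φ ε ω) i ≠ y (Φ ε ω) j := by
      simp only [ae_all_iff]
      exact fun ε i j => (hΦ ε).quasiMeasurePreserving.ae (hne i j)
    have h2 : ∀ᵐ ω ∂Q, ∀ ε : Fin n → Bool, ∀ i, y (Φ ε ω) i ≠ ⊥ := by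
      simp only [ae_all_iff]
      exact fun ε i => (hΦ ε).quasiMeasurePreserving.ae (hne_bot i)
    filter_upwards [h1, h2] with ω h1 h2
    refine ⟨?_, ?_⟩
    · rintro ⟨i, b⟩ ⟨j, d⟩ heq
      by_contra hcon
      -- This exchange makes the first of the two colliding keys a sample and the second a value, so
      -- the hypothesis on a sample against a value suffices for all pairs of keys.
      refine h1 (fun a => if a = i then !b else d) i j ?_
      rw [hx, hy]
      by_cases hij : j = i
      · subst hij
        obtain rfl : d = !b := by
          revert hcon
          cases b <;> cases d <;> simp
        simpa using heq
      · simpa [hij] using heq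
    · rintro ⟨i, b⟩
      have := h2 (fun _ => b) i
      rw [hy] at this
      exact bot_lt_iff_ne_bot.2 this
  have hpoint : ∀ᵐ ω ∂Q, ENNReal.ofReal (1 - 44 / √(k : ℝ)) * ∑ ε, opt (Φ ε ω) ≤
      ∑ ε, ⨅ π, rew (Φ ε ω) π := by
    -- For each exchange the worst order is chosen separately; the averaged inequality allows the
    -- order to depend on `ε`.
    filter_upwards [hgood] with ω hω
    choose π hπ using fun ε : Fin n → Bool => exists_eq_ciInf_of_finite (f := rew (Φ ε ω))
    have hval : ∀ ε i, (Φ ε ω).2.2 i = num (κ ω (i, ε i)) := fun ε i => by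
      rw [← hy, hnumv]
    have h1 := mul_sum_optValue_le hk num hnum (κ ω) hω.1 hω.2 (fun ε => List.ofFn (π ε))
      (fun ε => List.nodup_ofFn.2 (π ε).injective)
      (fun ε i => List.mem_ofFn.2 ((π ε).surjective i))
    refine le_trans (le_of_eq ?_) (h1.trans (le_of_eq ?_))
    · congr 1
      refine sum_congr rfl fun ε _ => ?_
      simp only [opt]
      congr 1
      exact funext fun i => hval ε i
    · refine sum_congr rfl fun ε _ => ?_
      rw [← hπ]
      have h2 : x (Φ ε ω) = fun i => κ ω (i, !ε i) := funext (hx ε ω)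
      have h3 : y (Φ ε ω) = fun i => κ ω (i, ε i) := funext (hy ε ω)
      simp only [rew, h2, h3, hval]
  have hint : (2 : ℝ≥0∞) ^ n * (ENNReal.ofReal (1 - 44 / √(k : ℝ)) * ∫⁻ ω, opt ω ∂Q) ≤
      2 ^ n * ∫⁻ ω, ⨅ π, rew ω π ∂Q := by
    have h1 : ∀ f : R × (Fin n → ℝ≥0) × (Fin n → ℝ≥0) → ℝ≥0∞, Measurable f →
        ∫⁻ ω, ∑ ε, f (Φ ε ω) ∂Q = 2 ^ n * ∫⁻ ω, f ω ∂Q := by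
      intro f hf
      have hfΦ : ∀ ε, Measurable fun ω => f (Φ ε ω) := fun ε => hf.comp (hΦ ε).measurable
      rw [lintegral_finsetSum _ fun ε _ => hfΦ ε, sum_congr rfl fun ε _ => (hΦ ε).lintegral_comp hf]
      simp
    calc (2 : ℝ≥0∞) ^ n * (ENNReal.ofReal (1 - 44 / √(k : ℝ)) * ∫⁻ ω, opt ω ∂Q)
        = ∫⁻ ω, ENNReal.ofReal (1 - 44 / √(k : ℝ)) * ∑ ε, opt (Φ ε ω) ∂Q := by
          have hoptΦ : ∀ ε, Measurable fun ω => opt (Φ ε ω) := fun ε =>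
            hopt.comp (hΦ ε).measurable
          rw [lintegral_const_mul _ (Finset.measurable_sum _ fun ε _ => hoptΦ ε), h1 opt hopt]
          ring
      _ ≤ ∫⁻ ω, ∑ ε, ⨅ π, rew (Φ ε ω) π ∂Q := lintegral_mono_ae hpoint
      _ = 2 ^ n * ∫⁻ ω, ⨅ π, rew ω π ∂Q := h1 _ hrew
  -- The factor `2 ^ n` is nonzero and finite, so it cancels even when the expectations are
  -- infinite.
  rw [ENNReal.mul_le_mul_iff_right (by simp) (by simp)] at hint
  have hmarg : ∫⁻ ω, opt ω ∂Q = ∫⁻ v, optValue (uniformFeasible n k) v ∂Measure.pi D :=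
    (measurePreserving_snd.comp measurePreserving_snd).lintegral_comp (measurable_optValue _)
  rw [← hmarg]
  refine hint.trans (lintegral_mono fun ω => ?_)
  refine (iInf_le _ (order ω.1 ω.2.1 ω.2.2)).trans (le_of_eq ?_)
  rw [SingleSampleAlgorithm.reward, accepted_rehearsal]

end Competitive

/-! ### The plain and the tie-breaking version -/

theorem hasCompetitiveRatio_plainRehearsal {n k : ℕ} (hk : 44 < √(k : ℝ))
    (D : Fin n → Measure ℝ≥0) [∀ i, IsProbabilityMeasure (D i)] [∀ i, NullSingletonClass (D i)] :
    (plainRehearsal n k).HasCompetitiveRatio (uniformFeasible n k) (Measure.dirac ()) D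
      (ENNReal.ofReal (1 - 44 / √(k : ℝ))) := by
  refine hasCompetitiveRatio_rehearsal _ D hk _ _ id monotone_id (fun _ _ _ => rfl)
    (fun _ => id) (fun _ => MeasurePreserving.id _) (fun _ _ _ _ => by simp)
    (fun _ _ _ _ => by simp) ?_ ?_ ?_ ?_
  · exact fun i j => measurableSet_le (by fun_prop) (by fun_prop)
  · exact fun i => measurableSet_lt (by fun_prop) (by fun_prop)
  · exact fun i j => measurePreserving_snd.quasiMeasurePreserving.ae (ae_ne_of_null_singleton D i j)
  · exact fun i => measurePreserving_snd.quasiMeasurePreserving.ae (ae_snd_ne_of_null_singleton D i ⊥)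

theorem hasCompetitiveRatio_tieBreakingRehearsal {n k : ℕ} (hk : 44 < √(k : ℝ))
    (D : Fin n → Measure ℝ≥0) [∀ i, IsProbabilityMeasure (D i)] :
    (tieBreakingRehearsal n k).HasCompetitiveRatio (uniformFeasible n k) volume D
      (ENNReal.ofReal (1 - 44 / √(k : ℝ))) := by
  refine hasCompetitiveRatio_rehearsal _ D hk _ _ (fun z => (ofLex z).1)
    Prod.Lex.monotone_fst_ofLex (fun _ _ _ => rfl)
    swapPairs (measurePreserving_swapPairs fun _ => volume) (fun ε _ i _ => by
      cases h : ε i <;> simp [swapPairs, h])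
    (fun ε _ i _ => by cases h : ε i <;> simp [swapPairs, h]) ?_ ?_ ?_ ?_
  · intro i j
    simp only [Prod.Lex.toLex_le_toLex]
    refine (measurableSet_lt (by fun_prop) (by fun_prop)).union
      (MeasurableSet.inter (measurableSet_eq_fun (by fun_prop) (by fun_prop))
        (measurableSet_le (by fun_prop) (by fun_prop)))
  · intro i
    have h : (⊥ : ℝ≥0 ×ₗ unitInterval) = toLex (⊥, ⊥) := rfl
    simp only [h, Prod.Lex.toLex_lt_toLex]
    refine (measurableSet_lt (by fun_prop) (by fun_prop)).union
      (MeasurableSet.inter (measurableSet_eq_fun (by fun_prop) (by fun_prop))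
        (measurableSet_lt (by fun_prop) (by fun_prop)))
  -- Two independent uniform coins almost surely differ, so the keys differ whatever atoms `D` has;
  -- likewise a coin is almost surely not 0, so no value key equals `(0, 0)`.
  · intro i j
    have := (measurePreserving_fst (μ := (volume : Measure ((Fin n → unitInterval) ×
      (Fin n → unitInterval)))) (ν := (Measure.pi D).prod (Measure.pi D))).quasiMeasurePreserving.ae
      (ae_ne_of_null_singleton (fun _ => (volume : Measure unitInterval)) i j)
    filter_upwards [this] with ω hω h
    exact hω (congrArg (fun z => (ofLex z).2) h)
  · intro i
    have := (measurePreserving_fst (μ := (volume : Measure ((Fin n → unitInterval) ×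
      (Fin n → unitInterval)))) (ν := (Measure.pi D).prod (Measure.pi D))).quasiMeasurePreserving.ae
      (ae_snd_ne_of_null_singleton (fun _ => (volume : Measure unitInterval)) i ⊥)
    filter_upwards [this] with ω hω h
    exact hω (congrArg (fun z => (ofLex z).2) h)

theorem SingleSampleAlgorithm.hasCompetitiveRatio_zero {n : ℕ} {R St : Type}
    (A : SingleSampleAlgorithm n R St) (J : Set (Finset (Fin n))) [MeasurableSpace R]
    (P : Measure R) (D : Fin n → Measure ℝ≥0) : A.HasCompetitiveRatio J P D 0 := fun _ => by
  simp

theorem ofReal_one_sub_eq_zero {k : ℕ} (hk : 0 < k) (h : ¬ 44 < √(k : ℝ)) :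
    ENNReal.ofReal (1 - 44 / √(k : ℝ)) = 0 := by
  have h0 : 0 < √(k : ℝ) := Real.sqrt_pos.2 (by exact_mod_cast hk)
  rw [ENNReal.ofReal_eq_zero, sub_nonpos, one_le_div h0]
  exact not_lt.1 h

end

/-- The Rehearsal Algorithm is a single-sample prophet inequality for `k`-uniform matroids with
competitive ratio `1 - O(1/√k)`: in its plain form if no `D i` has atoms, so that almost surely
there are no ties, and with random tie-breaking (independent uniform coins) for all `D`. -/
theorem theorem2 :
    ∃ C : ℝ, ∀ n k : ℕ, 0 < k →
      ((plainRehearsal n k).IsFeasible (uniformFeasible n k) ∧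
        ∀ D : Fin n → Measure ℝ≥0, (∀ i, IsProbabilityMeasure (D i)) → (∀ i x, D i {x} = 0) →
          (plainRehearsal n k).HasCompetitiveRatio (uniformFeasible n k) (Measure.dirac ()) D
            (ENNReal.ofReal (1 - C / √(k : ℝ)))) ∧
      ((tieBreakingRehearsal n k).IsFeasible (uniformFeasible n k) ∧
        ∀ D : Fin n → Measure ℝ≥0, (∀ i, IsProbabilityMeasure (D i)) →
          (tieBreakingRehearsal n k).HasCompetitiveRatio (uniformFeasible n k) volume D
            (ENNReal.ofReal (1 - C / √(k : ℝ)))) := by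
  -- For `√k ≤ 44` the ratio is 0 and nothing is claimed, so the convention for `numTop k = 0`
  -- matters only for feasibility.
  refine ⟨44, fun n k hk => ⟨⟨isFeasible_rehearsal hk _ _, fun D hD hatom => ?_⟩,
    isFeasible_rehearsal hk _ _, fun D hD => ?_⟩⟩
  · by_cases h : 44 < √(k : ℝ)
    · have : ∀ i, NullSingletonClass (D i) := fun i => ⟨hatom i⟩
      exact hasCompetitiveRatio_plainRehearsal h D
    · rw [ofReal_one_sub_eq_zero hk h]
      exact SingleSampleAlgorithm.hasCompetitiveRatio_zero _ _ _ _
  · by_cases h : 44 < √(k : ℝ)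
    · exact hasCompetitiveRatio_tieBreakingRehearsal h D
    · rw [ofReal_one_sub_eq_zero hk h]
      exact SingleSampleAlgorithm.hasCompetitiveRatio_zero _ _ _ _
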